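/- **Setting.** A chain is a triple $(\mathcal X,K,\pi)$, where $\mathcal X$ is a countable set, $K$ is an irreducible stochastic matrix on $\mathcal X$ and $\pi$ is a probability on $\mathcal X$ with $\pi K=\pi$. The associated continuous time chain has transition matrices $H_t=e^{-t(I-K)}$, $t\ge 0$. Its maximum total variation and maximum Hellinger distance are $$d_{TV}(t)=\sup_{x\in\mathcal X,\,A\subseteq\mathcal X}\{H_t(x,A)-\pi(A)\},\qquad d_H(t)=\sup_{x\in\mathcal X}\Big(\tfrac12\sum_{y\in\mathcal X}\big(\sqrt{H_t(x,y)}-\sqrt{\pi(y)}\big)^2\Big)^{1/2},$$ and for $*\in\{TV,H\}$ its mixing time is $T_*(\epsilon)=\inf\{t\ge0: d_*(t)\le\epsilon\}\in[0,\infty]$. For a family $\mathcal G=(\mathcal X_n,K_n,\pi_n)_{n\ge1}$, let $\mathcal G_c$ be the family of associated continuous time chains and let $d_{n,*},T_{n,*}$ be the distance and mixing time of its $n$th member. $\mathcal G_c$ has a cutoff (with respect to $*$) with cutoff time $(t_n)_{n\ge1}$, $t_n>0$, if $\lim_n d_{n,*}(at_n)=0$ for all $a>1$ and $\lim_n d_{n,*}(at_n)=1$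 for all $0<a<1$; it has a cutoff if it has one with some cutoff time. The product of $(\mathcal X_i,K_i,\pi_i)_{i=1}^n$ according to a probability vector $(w_1,\dots,w_n)$ is the chain on $\mathcal X_1\times\cdots\times\mathcal X_n$ with stationary distribution $\pi_1\times\cdots\times\pi_n$ and transition matrix $\sum_{i=1}^n w_i\, I_1\otimes\cdots\otimes I_{i-1}\otimes K_i\otimes I_{i+1}\otimes\cdots\otimes I_n$. Given a family $\mathcal F=(\mathcal X_n,K_n,\pi_n)_{n\ge1}$ of chains and a sequence $\mathcal P=(p_n)_{n\ge1}$ of positive reals, put $q_n=p_1+\cdots+p_n$ and let $\mathcal F^{\mathcal P}$ be the family whose $n$th member is the product of $(\mathcal X_i,K_i,\pi_i)_{i=1}^n$ according to $(p_1/q_n,\dots,p_n/q_n)$. For a (strictly) increasing sequence $\xi=(\xi_n)_{n\ge1}$ of positive integers let $\mathcal F_\xi=(\mathcal X_{\xi_n},K_{\xi_n},\pi_{\xi_n})_{n\ge1}$, $\mathcal P_\xi=(p_{\xi_n})_{n\ge1}$ and $\mathcal F^{\mathcal P,\xi}=(\mathcal F_\xi)^{\mathcal P_\xi}$. The subfamilies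 of $\mathcal F_c$ are the families $(\mathcal F_\xi)_c$. **Theorem 4.7.** Let $*\in\{TV,H\}$, $\varrho_{TV}=1$, $\varrho_H=2$, and let $T_{n,*}$ be the mixing time of the $n$th chain in $\mathcal F_c$. Assume that there are $c_0\in(0,1)$, $N>0$ and a sequence $(\epsilon_n)_{n\ge1}$ with $0<\inf_n\epsilon_n\le\sup_n\epsilon_n<1/(2\varrho_*)$ such that $$\max_{1\le i\le n}\frac{T_{i,*}(\epsilon_i)}{p_i}=\frac{T_{n,*}(\epsilon_n)}{p_n}\quad\text{for all } n\ge N$$ and $$\lim_{m\to\infty}\limsup_{n\to\infty}\sum_{i=1}^{n-m}\Big(2\varrho_*\sup_{k\ge1}\epsilon_k\Big)^{c_0\varrho_*\,T_{n,*}(\epsilon_n)p_i/(T_{i,*}(\epsilon_i)p_n)}=0 .$$ (If mixing times $0$ or $\infty$ occur, the exponent is read in $[0,\infty]$ with $a/0=\infty$ for $a>0$, $0/0=\infty/\infty=0$, and $b^\infty=0$ for $0<b<1$.) Then, with all cutoffs taken with respect to $*$: 1. $\mathcal F_c$ has a cutoff if and only if $\mathcal F^{\mathcal P,\xi}_c$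 has a cutoff for every increasing sequence $\xi$ of positive integers. In particular, if $\mathcal F_c$ has a cutoff, then $\mathcal F^{\mathcal P}_c$ has a cutoff. 2. No subfamily of $\mathcal F_c$ has a cutoff if and only if, for every increasing sequence $\xi$ of positive integers, $\mathcal F^{\mathcal P,\xi}_c$ has no cutoff. In particular, if no subfamily of $\mathcal F_c$ has a cutoff, then $\mathcal F^{\mathcal P}_c$ has no cutoff. 3. If $(t_n)$ is a cutoff time for $\mathcal F_c$, then $(q_nt_n/p_n)$ is a cutoff time for $\mathcal F^{\mathcal P}_c$. -/

import Mathlib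

open Filter Topology
open scoped ENNReal NNReal

universe u

noncomputable section

namespace ProductCutoff

/-- A triple `(X, K, π)`: a set, a matrix and a vector indexed by it. The laws that make it an
irreducible Markov chain are collected in `MarkovTriple.IsIrreducibleChain`. -/
structure MarkovTriple : Type (u + 1) where
  /-- the state space `X` -/
  State : Type u
  /-- the transition matrix `K` -/
  K : State → State → ℝ
  /-- the stationary distribution `π` -/
  stat : State → ℝ

namespace MarkovTriple

open Classical in
/-- The matrix power `K ^ m`. -/
def iter (M : MarkovTriple.{u}) : ℕ → M.State → M.State → ℝ
  | 0 => fun x y => if x = y then 1 else 0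
  | m + 1 => fun x y => ∑' z, M.iter m x z * M.K z y

/-- `X` is countable, `K` is an irreducible stochastic matrix on `X`, and `π` is a probability
on `X` with `π K = π`. -/
structure IsIrreducibleChain (M : MarkovTriple.{u}) : Prop where
  countable : Countable M.State
  K_nonneg : ∀ x y, 0 ≤ M.K x y
  K_sum : ∀ x, HasSum (fun y => M.K x y) 1
  irreducible : ∀ x y, ∃ m, 0 < M.iter m x y
  stat_nonneg : ∀ x, 0 ≤ M.stat x
  stat_sum : HasSum M.stat 1
  stationary : ∀ y, HasSum (fun x => M.stat x * M.K x y) (M.stat y)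

/-- The transition matrix `H_t = exp (-t (I - K)) = e^{-t} ∑ₘ (t^m / m!) K^m` of the associated
continuous time chain. -/
def heat (M : MarkovTriple.{u}) (t : ℝ) (x y : M.State) : ℝ :=
  ∑' m : ℕ, Real.exp (-t) * (t ^ m / (m.factorial : ℝ)) * M.iter m x y

/-- The maximum total variation of the continuous time chain,
`sup { H_t(x, A) - π(A) : x ∈ X, A ⊆ X }`. -/
def dTV (M : MarkovTriple.{u}) (t : ℝ) : ℝ :=
  ⨆ q : M.State × Set M.State, ((∑' y : q.2, M.heat t q.1 y) - ∑' y : q.2, M.stat y)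

/-- The maximum Hellinger distance of the continuous time chain. -/
def dH (M : MarkovTriple.{u}) (t : ℝ) : ℝ :=
  ⨆ x : M.State, √((1 / 2) * ∑' y, (√(M.heat t x y) - √(M.stat y)) ^ 2)

end MarkovTriple

/-- The two ways of measuring distance to stationarity. -/
inductive Distance
  | totalVariation
  | hellinger

/-- The constant `ϱ` attached to a distance: `1` for total variation, `2` for Hellinger. -/
def Distance.rho : Distance → ℝ
  | .totalVariation => 1
  | .hellinger => 2

/-- The maximum distance to stationarity at time `t` of the continuous time chain. -/
def maxDist : Distance → MarkovTriple.{u} → ℝ → ℝ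
  | .totalVariation, M, t => M.dTV t
  | .hellinger, M, t => M.dH t

/-- The mixing time `T(ε) = inf {t ≥ 0 : d(t) ≤ ε}` of the continuous time chain, with values in
`[0, ∞]` (`inf ∅ = ∞`). -/
def mixingTime (δ : Distance) (M : MarkovTriple.{u}) (ε : ℝ) : ℝ≥0∞ :=
  ⨅ (t : ℝ≥0) (_ : maxDist δ M (t : ℝ) ≤ ε), (t : ℝ≥0∞)

/-- `t` is a cutoff time for the family of continuous time chains associated with `F`. -/
def IsCutoffTime (δ : Distance) (F : ℕ → MarkovTriple.{u}) (t : ℕ → ℝ) : Prop :=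
  (∀ n, 0 < t n) ∧
  (∀ a : ℝ, 1 < a → Tendsto (fun n => maxDist δ (F n) (a * t n)) atTop (𝓝 0)) ∧
  (∀ a : ℝ, 0 < a → a < 1 → Tendsto (fun n => maxDist δ (F n) (a * t n)) atTop (𝓝 1))

/-- The family of continuous time chains associated with `F` has a cutoff. -/
def HasCutoff (δ : Distance) (F : ℕ → MarkovTriple.{u}) : Prop :=
  ∃ t : ℕ → ℝ, IsCutoffTime δ F t

open Classical in
/-- The product chain of `(M i)` according to the vector `w`: the state space is `∏ X_i`, the
stationary distribution is `⊗ π_i`, and the transition matrix is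
`∑ᵢ wᵢ I ⊗ ⋯ ⊗ I ⊗ Kᵢ ⊗ I ⊗ ⋯ ⊗ I`. -/
def productChain {ι : Type} [Fintype ι] (M : ι → MarkovTriple.{u}) (w : ι → ℝ) :
    MarkovTriple.{u} where
  State := ∀ i, (M i).State
  K := fun x y => ∑ i, w i *
    ((M i).K (x i) (y i) * ∏ j ∈ Finset.univ.erase i, if x j = y j then (1 : ℝ) else 0)
  stat := fun x => ∏ i, (M i).stat (x i)

/-- The partial sums `p_0 + ⋯ + p_n`. -/
def partialSum (p : ℕ → ℝ) (n : ℕ) : ℝ := ∑ i ∈ Finset.range (n + 1), p i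

/-- The family of product chains: its `n`-th member is the product of the chains `0, …, n` of `F`
according to the probability vector `(p_0 / q_n, …, p_n / q_n)`, where `q_n = p_0 + ⋯ + p_n`. -/
def productFamily (F : ℕ → MarkovTriple.{u}) (p : ℕ → ℝ) (n : ℕ) : MarkovTriple.{u} :=
  productChain (fun i : Fin (n + 1) => F i) (fun i : Fin (n + 1) => p i / partialSum p n)

open Classical in
/-- The power `b ^ x` for a base `0 < b < 1` and an exponent `x ∈ [0, ∞]`, with `b ^ ∞ = 0`. -/
def powInf (b : ℝ) (x : ℝ≥0∞) : ℝ≥0∞ :=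
  if x = ∞ then 0 else ENNReal.ofReal (b ^ x.toReal)

end ProductCutoff

end

open ProductCutoff

/-!
# Cutoffs for product chains

The heat kernel of a product chain factorizes, which bounds its distance to stationarity by those
of its factors; cutoffs of the products are then compared with cutoffs of the family.
-/

/-! Let `d` be the distance of a factor, `D` that of the product, `ϱ` the order (1 or 2) and `S n`
the mixing time of the `n`th chain divided by `p n`. For both distances `d ^ ϱ` is the supremum over
starting points of one minus an overlap: the sum of the minima of the two masses for total
variation, of their geometric means for Hellinger. The overlap does not decrease under stochastic
kernels (`overlap_le_overlap`) and is at least multiplicative on products (`prod_overlap_le`).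

The coordinate generators of a product commute, so its heat kernel at time `q_n s` is the product of
the kernels of the factors at times `p_i s` (`heat_productChain`). Hence `d_n(p_n s) ≤ D_n(q_n s)`
by projection to the last coordinate, and `D_n(q_n s) ^ ϱ ≤ 1 - ∏ (1 - d_i(p_i s) ^ ϱ)`.

Submultiplicativity, `d(s + t) ≤ 2ϱ d(s) d(t)` (`maxDist_add_le`), turns the summation hypothesis
into a tail bound: for every `a > c₀`, at the common time `a * S n` all factors but a bounded number
of late ones together contribute as little as desired (`isRegular_of_mixingTime`). By maximality of
`S n`, each late factor has then run for at least `a` times its own mixing time. So `p_n S_n` for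
the family and `q_n S_n` for the products are reference times: if a cutoff exists, it occurs there.

Below the reference time, projection passes distance near 1 from the family to the products; above
it, the tail bound and the bounded number of late factors pass distance near 0. This gives the
cutoff time of the products. Conversely, distance near 0 passes back by projection. For distance
near 1, thin the family so that all factors but the last contribute at most 1/2; a product distance
tending to 1 then forces that of the last factor to 1 (`exists_sparse`). If only the full product
has a cutoff, then, the number of late factors being bounded, some chains arbitrarily far out are
nearly unmixed just before their reference time, and a diagonal choice of them is a subfamily with a
cutoff (`exists_subfamily_hasCutoff`). -/

namespace ProductCutoff

/-! ### Operators on `ℓ¹`, determined by their values on unit masses. -/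

/-- The Banach space of absolutely summable real families. -/
abbrev SummableSpace (α : Type*) := lp (fun _ : α => ℝ) 1

section SummableSpace

open Classical in
/-- The unit mass at a point. -/
noncomputable def pointMass {α : Type*} (a : α) : SummableSpace α := lp.single 1 a 1

variable {α β : Type*}

open Classical in
theorem pointMass_apply (a b : α) : pointMass a b = if a = b then 1 else 0 := by
  simp [pointMass, lp.single_apply, Pi.single_apply, eq_comm]

theorem norm_pointMass (a : α) : ‖pointMass a‖ = 1 := by
  classical
  simp [pointMass, lp.norm_single]

theorem hasSum_abs_norm (f : SummableSpace α) : HasSum (fun a => |f a|) ‖f‖ := by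
  simpa using lp.hasSum_norm (by simp) f

theorem summable_apply (f : SummableSpace α) : Summable f :=
  (hasSum_abs_norm f).summable.of_abs

/-- An absolutely summable family as an element of the Banach space. -/
def ofSummable (f : α → ℝ) (hf : Summable fun a => |f a|) : SummableSpace α :=
  ⟨f, memℓp_gen (by simpa using hf)⟩

@[simp] theorem ofSummable_apply (f : α → ℝ) (hf : Summable fun a => |f a|) (a : α) :
    ofSummable f hf a = f a := rfl

theorem hasSum_smul_pointMass (f : SummableSpace α) :
    HasSum (fun a => f a • pointMass a) f := by
  classical
  have := lp.hasSum_single (p := 1) (by simp) f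
  convert this using 2 with a
  rw [pointMass, ← lp.single_smul, smul_eq_mul, mul_one]

/-- Evaluation at a point. -/
noncomputable def evalAt (b : α) : SummableSpace α →L[ℝ] ℝ :=
  LinearMap.mkContinuous
    { toFun := fun f => f b
      map_add' := fun f g => rfl
      map_smul' := fun c f => rfl } 1 (fun f => by
        rw [one_mul]
        exact lp.norm_apply_le_norm one_ne_zero f b)

@[simp] theorem evalAt_apply (b : α) (f : SummableSpace α) : evalAt b f = f b := rfl

/-- The sum of an absolutely summable family. -/
noncomputable def totalSum : SummableSpace α →L[ℝ] ℝ :=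
  LinearMap.mkContinuous
    { toFun := fun f => ∑' a, f a
      map_add' := fun f g => (summable_apply f).tsum_add (summable_apply g)
      map_smul' := fun c f => tsum_mul_left } 1 (fun f => by
        rw [one_mul, ← (hasSum_abs_norm f).tsum_eq]
        exact norm_tsum_le_tsum_norm (hasSum_abs_norm f).summable)

theorem totalSum_apply (f : SummableSpace α) : totalSum f = ∑' a, f a := rfl

theorem totalSum_pointMass (a : α) : totalSum (pointMass a) = 1 := by
  rw [totalSum_apply, tsum_eq_single a]
  · simp [pointMass_apply]
  · intro b hb
    simp [pointMass_apply, hb.symm]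

variable {E : Type*} [NormedAddCommGroup E] [NormedSpace ℝ E]

theorem summable_smul_of_norm_le_one (k : α → E) (hk : ∀ a, ‖k a‖ ≤ 1) (f : SummableSpace α) :
    Summable fun a => ‖f a • k a‖ :=
  (hasSum_abs_norm f).summable.of_nonneg_of_le (fun _ => norm_nonneg _) (fun a => by
    rw [norm_smul]; exact mul_le_of_le_one_right (norm_nonneg _) (hk a))

section Complete

variable [CompleteSpace E]

/-- The operator that sends the unit mass at `a` to `k a`. -/
noncomputable def kernelOp (k : α → E) (hk : ∀ a, ‖k a‖ ≤ 1) : SummableSpace α →L[ℝ] E :=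
  LinearMap.mkContinuous
    { toFun := fun f => ∑' a, f a • k a
      map_add' := fun f g => by
        rw [← (summable_smul_of_norm_le_one k hk f).of_norm.tsum_add
          (summable_smul_of_norm_le_one k hk g).of_norm]
        simp [add_smul]
      map_smul' := fun c f => by
        simp only [lp.coeFn_smul, Pi.smul_apply, RingHom.id_apply, smul_assoc]
        exact (summable_smul_of_norm_le_one k hk f).of_norm.tsum_const_smul c } 1 (fun f => by
        rw [one_mul, ← (hasSum_abs_norm f).tsum_eq]
        simp only [LinearMap.coe_mk, AddHom.coe_mk]
        refine (norm_tsum_le_tsum_norm (summable_smul_of_norm_le_one k hk f)).trans ?_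
        refine (summable_smul_of_norm_le_one k hk f).tsum_le_tsum (fun a => ?_)
          (hasSum_abs_norm f).summable
        rw [norm_smul]; exact mul_le_of_le_one_right (norm_nonneg _) (hk a))

theorem kernelOp_pointMass (k : α → E) (hk : ∀ a, ‖k a‖ ≤ 1) (a : α) :
    kernelOp k hk (pointMass a) = k a := by
  classical
  change ∑' b, pointMass a b • k b = k a
  rw [tsum_eq_single a]
  · simp [pointMass_apply]
  · intro b hb
    simp [pointMass_apply, hb.symm]

end Complete

theorem hasSum_apply_pointMass (T : SummableSpace α →L[ℝ] E) (f : SummableSpace α) :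
    HasSum (fun a => f a • T (pointMass a)) (T f) := by
  simpa using T.hasSum (hasSum_smul_pointMass f)

theorem ext_pointMass {T T' : SummableSpace α →L[ℝ] E}
    (h : ∀ a, T (pointMass a) = T' (pointMass a)) : T = T' := by
  ext1 f
  refine (hasSum_apply_pointMass T f).unique ?_
  simpa [h] using hasSum_apply_pointMass T' f

/-- The entries of an operator, read from its values on unit masses. -/
theorem hasSum_apply (T : SummableSpace α →L[ℝ] SummableSpace β) (f : SummableSpace α) (b : β) :
    HasSum (fun a => f a * T (pointMass a) b) (T f b) := by
  simpa using (evalAt b).hasSum (hasSum_apply_pointMass T f)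

end SummableSpace

/-! ### Exponentials of bounded operators. -/

section Exponential

variable {α β : Type*}

theorem hasSum_exp_smul (T : SummableSpace α →L[ℝ] SummableSpace α) (t : ℝ) :
    HasSum (fun m : ℕ => (t ^ m / (m.factorial : ℝ)) • T ^ m) (NormedSpace.exp (t • T)) := by
  simpa only [smul_pow, smul_smul, div_eq_inv_mul] using
    NormedSpace.exp_series_hasSum_exp' (𝕂 := ℝ) (t • T)

theorem exp_add_of_commute {A : Type*} [NormedRing A] [NormedAlgebra ℝ A] [CompleteSpace A]
    {x y : A} (h : Commute x y) :
    NormedSpace.exp (x + y) = NormedSpace.exp x * NormedSpace.exp y :=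
  NormedSpace.exp_add_of_commute_of_mem_ball (𝕂 := ℝ) h
    ((NormedSpace.expSeries_radius_eq_top ℝ A).symm ▸ edist_lt_top _ _)
    ((NormedSpace.expSeries_radius_eq_top ℝ A).symm ▸ edist_lt_top _ _)

theorem exp_smul_sub_one (T : SummableSpace α →L[ℝ] SummableSpace α) (t : ℝ) :
    NormedSpace.exp (t • (T - 1)) = Real.exp (-t) • NormedSpace.exp (t • T) := by
  have h : t • (T - 1) = t • T + (-t) • (1 : SummableSpace α →L[ℝ] SummableSpace α) := by
    rw [smul_sub, neg_smul, sub_eq_add_neg]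
  have h1 : NormedSpace.exp ((-t) • (1 : SummableSpace α →L[ℝ] SummableSpace α)) =
      Real.exp (-t) • 1 := by
    rw [← Algebra.algebraMap_eq_smul_one, ← Algebra.algebraMap_eq_smul_one, Real.exp_eq_exp_ℝ,
      ← NormedSpace.algebraMap_exp_comm]
  rw [h, exp_add_of_commute, h1]
  · simp
  · exact (Commute.one_right _).smul_right _

/-- A linear map that intertwines two operators intertwines their exponentials. -/
theorem comp_exp_smul {T : SummableSpace α →L[ℝ] SummableSpace α}
    {T' : SummableSpace β →L[ℝ] SummableSpace β} {J : SummableSpace α →L[ℝ] SummableSpace β}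
    (h : ∀ v, T' (J v) = J (T v)) (t : ℝ) (v : SummableSpace α) :
    NormedSpace.exp (t • T') (J v) = J (NormedSpace.exp (t • T) v) := by
  have hpow : ∀ (m : ℕ) v, (T' ^ m) (J v) = J ((T ^ m) v) := by
    intro m
    induction m with
    | zero => intro v; rfl
    | succ m ih =>
      intro v
      rw [pow_succ, pow_succ, mul_apply_eq_comp, mul_apply_eq_comp, h, ih]
  have h1 := (hasSum_exp_smul T' t).mapL (ContinuousLinearMap.apply ℝ _ (J v))
  have h2 := ((hasSum_exp_smul T t).mapL (ContinuousLinearMap.apply ℝ _ v)).mapL J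
  refine h1.unique ?_
  simpa [hpow] using h2

theorem hasSum_pow_div_factorial (t : ℝ) :
    HasSum (fun m : ℕ => t ^ m / (m.factorial : ℝ)) (Real.exp t) := by
  rw [Real.exp_eq_exp_ℝ]
  exact NormedSpace.expSeries_div_hasSum_exp t

/-- A functional invariant under `T` is invariant under `exp (t (T - 1))`. -/
theorem apply_exp_smul_sub_one {E : Type*} [NormedAddCommGroup E] [NormedSpace ℝ E]
    {T : SummableSpace α →L[ℝ] SummableSpace α} {φ : SummableSpace α →L[ℝ] E}
    {v : SummableSpace α} (h : ∀ m : ℕ, φ ((T ^ m) v) = φ v) (t : ℝ) :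
    φ (NormedSpace.exp (t • (T - 1)) v) = φ v := by
  have h1 := ((hasSum_exp_smul T t).mapL (ContinuousLinearMap.apply ℝ _ v)).mapL φ
  have h2 : φ (NormedSpace.exp (t • T) v) = Real.exp t • φ v := by
    refine h1.unique ?_
    simpa only [ContinuousLinearMap.apply_apply, _root_.smul_apply, map_smul, h] using
      (hasSum_pow_div_factorial t).smul_const (φ v)
  rw [exp_smul_sub_one, _root_.smul_apply, map_smul, h2, smul_smul, ← Real.exp_add]
  simp

end Exponential

/-! ### The heat semigroup of a single chain. -/

section Kernel

variable {α : Type*}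

/-- The operator `μ ↦ μ K` of a stochastic matrix. -/
noncomputable def rowOp (K : α → α → ℝ) (h0 : ∀ x y, 0 ≤ K x y) (h1 : ∀ x, HasSum (K x) 1) :
    SummableSpace α →L[ℝ] SummableSpace α :=
  kernelOp (fun x => ofSummable (K x) (h1 x).summable.abs) (fun x => by
    rw [← (hasSum_abs_norm _).tsum_eq]
    simp [abs_of_nonneg (h0 x _), (h1 x).tsum_eq])

theorem rowOp_pointMass_apply (K : α → α → ℝ) (h0 : ∀ x y, 0 ≤ K x y)
    (h1 : ∀ x, HasSum (K x) 1) (x y : α) : rowOp K h0 h1 (pointMass x) y = K x y := by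
  rw [rowOp, kernelOp_pointMass, ofSummable_apply]

end Kernel

/-- The laws of a stochastic matrix with a stationary probability. -/
structure MarkovTriple.IsStationaryChain (M : MarkovTriple.{u}) : Prop where
  K_nonneg : ∀ x y, 0 ≤ M.K x y
  K_sum : ∀ x, HasSum (M.K x) 1
  stat_nonneg : ∀ x, 0 ≤ M.stat x
  stat_sum : HasSum M.stat 1
  stationary : ∀ y, HasSum (fun x => M.stat x * M.K x y) (M.stat y)

theorem MarkovTriple.IsIrreducibleChain.isStationaryChain {M : MarkovTriple.{u}}
    (h : M.IsIrreducibleChain) : M.IsStationaryChain :=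
  ⟨h.K_nonneg, h.K_sum, h.stat_nonneg, h.stat_sum, h.stationary⟩

namespace MarkovTriple.IsStationaryChain

variable {M : MarkovTriple.{u}}

/-- The operator `μ ↦ μ K`. -/
noncomputable def op (h : M.IsStationaryChain) : SummableSpace M.State →L[ℝ] SummableSpace M.State :=
  rowOp M.K h.K_nonneg h.K_sum

/-- The operator `μ ↦ μ H_t`. -/
noncomputable def heatOp (h : M.IsStationaryChain) (t : ℝ) : SummableSpace M.State →L[ℝ] SummableSpace M.State :=
  NormedSpace.exp (t • (h.op - 1))

theorem op_pointMass (h : M.IsStationaryChain) (x y : M.State) : h.op (pointMass x) y = M.K x y :=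
  rowOp_pointMass_apply _ _ _ _ _

theorem iter_eq (h : M.IsStationaryChain) (m : ℕ) (x y : M.State) : M.iter m x y = (h.op ^ m) (pointMass x) y := by
  induction m generalizing y with
  | zero => simp [MarkovTriple.iter, pointMass_apply]
  | succ m ih =>
    rw [pow_succ', mul_apply_eq_comp, ← (hasSum_apply h.op _ y).tsum_eq]
    simp only [MarkovTriple.iter, ih, op_pointMass]

/-- The exponential series converges in operator norm, so it may be evaluated at a unit mass and
then at a point; the `-1` in the generator supplies the factor `exp (-t)`. -/
theorem heat_eq (h : M.IsStationaryChain) (t : ℝ) (x y : M.State) : M.heat t x y = h.heatOp t (pointMass x) y := by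
  have h1 := ((hasSum_exp_smul h.op t).mapL
    (ContinuousLinearMap.apply ℝ _ (pointMass x))).mapL (evalAt y)
  have h2 := h1.mul_left (Real.exp (-t))
  rw [heatOp, exp_smul_sub_one]
  refine Eq.trans ?_ h2.tsum_eq
  simp only [MarkovTriple.heat, h.iter_eq]
  refine tsum_congr fun m => ?_
  simp [mul_assoc]

theorem iter_nonneg (h : M.IsStationaryChain) (m : ℕ) (x y : M.State) : 0 ≤ M.iter m x y := by
  induction m generalizing y with
  | zero => simp only [MarkovTriple.iter]; split_ifs <;> simp
  | succ m ih => exact tsum_nonneg fun z => mul_nonneg (ih z) (h.K_nonneg z y)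

theorem heat_nonneg (h : M.IsStationaryChain) {t : ℝ} (ht : 0 ≤ t) (x y : M.State) : 0 ≤ M.heat t x y :=
  tsum_nonneg fun m => mul_nonneg (by positivity) (h.iter_nonneg m x y)

theorem totalSum_op (h : M.IsStationaryChain) (v : SummableSpace M.State) : totalSum (h.op v) = totalSum v := by
  have : totalSum ∘L h.op = totalSum := ext_pointMass fun x => by
    rw [ContinuousLinearMap.comp_apply, totalSum_pointMass, totalSum_apply]
    simp only [op_pointMass, (h.K_sum x).tsum_eq]
  exact congrArg (fun φ => φ v) this

theorem heat_hasSum (h : M.IsStationaryChain) (t : ℝ) (x : M.State) : HasSum (M.heat t x) 1 := by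
  have h2 : totalSum (h.heatOp t (pointMass x)) = 1 := by
    rw [← totalSum_pointMass x]
    refine apply_exp_smul_sub_one (fun m => ?_) t
    induction m with
    | zero => rfl
    | succ m ih => rw [pow_succ', mul_apply_eq_comp, h.totalSum_op, ih]
  have h3 := (summable_apply (h.heatOp t (pointMass x))).hasSum
  rw [← totalSum_apply, h2] at h3
  rwa [show M.heat t x = h.heatOp t (pointMass x) from funext (h.heat_eq t x)]

/-- The Chapman–Kolmogorov equation. -/
theorem heat_add (h : M.IsStationaryChain) (s t : ℝ) (x y : M.State) :
    HasSum (fun z => M.heat s x z * M.heat t z y) (M.heat (s + t) x y) := by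
  have h1 : h.heatOp (s + t) = h.heatOp t * h.heatOp s := by
    rw [heatOp, add_comm, add_smul, exp_add_of_commute]
    · rfl
    · exact ((Commute.refl _).smul_left _).smul_right _
  have h2 := hasSum_apply (h.heatOp t) (h.heatOp s (pointMass x)) y
  rw [← mul_apply_eq_comp, ← h1] at h2
  simpa only [← h.heat_eq] using h2

theorem heat_stationary (h : M.IsStationaryChain) (t : ℝ) (y : M.State) :
    HasSum (fun x => M.stat x * M.heat t x y) (M.stat y) := by
  set v : SummableSpace M.State := ofSummable M.stat h.stat_sum.summable.abs with hv
  have h1 : h.op v = v := by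
    ext y
    refine (hasSum_apply h.op v y).unique ?_
    simpa only [hv, ofSummable_apply, op_pointMass] using h.stationary y
  have h2 : h.heatOp t v = v := by
    refine apply_exp_smul_sub_one (φ := ContinuousLinearMap.id ℝ _) (fun m => ?_) t
    induction m with
    | zero => rfl
    | succ m ih =>
      rw [pow_succ', mul_apply_eq_comp]
      simp only [ContinuousLinearMap.id_apply] at ih ⊢
      rw [ih, h1]
  have h3 := hasSum_apply (h.heatOp t) v y
  rw [h2] at h3
  simpa only [hv, ofSummable_apply, ← h.heat_eq] using h3

end MarkovTriple.IsStationaryChain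

theorem hasSum_of_eq {α : Type*} {f g : α → ℝ} {a : ℝ} (h : ∀ x, f x = g x) (hg : HasSum g a) :
    HasSum f a := by
  rwa [show f = g from funext h]

/-! ### Product chains: factorization of the heat kernel. -/

section OffDiagonal

variable {ι : Type} {X : ι → Type u}

open Classical in
/-- The indicator that `x` and `y` agree outside coordinate `i`. -/
noncomputable def agreeOff (i : ι) (x y : ∀ i, X i) : ℝ := if ∀ j, j ≠ i → x j = y j then 1 else 0

theorem agreeOff_comm (i : ι) (x y : ∀ i, X i) : agreeOff i x y = agreeOff i y x := by
  unfold agreeOff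
  congr 1
  exact propext (forall_congr' fun j => forall_congr' fun _ => eq_comm)

open Classical in
theorem prod_erase_eq_agreeOff [Fintype ι] (i : ι) (x y : ∀ i, X i) :
    (∏ j ∈ Finset.univ.erase i, if x j = y j then (1 : ℝ) else 0) = agreeOff i x y := by
  rw [agreeOff]
  split_ifs with h
  · exact Finset.prod_eq_one fun j hj => if_pos (h j (Finset.ne_of_mem_erase hj))
  · push Not at h
    obtain ⟨j, hj, hne⟩ := h
    exact Finset.prod_eq_zero (Finset.mem_erase.2 ⟨hj, Finset.mem_univ _⟩) (if_neg hne)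

theorem agreeOff_update_left [DecidableEq ι] (i : ι) (x y : ∀ i, X i) (z : X i) :
    agreeOff i (Function.update x i z) y = agreeOff i x y := by
  unfold agreeOff
  congr 1
  exact propext (forall_congr' fun j => forall_congr' fun hj => by
    rw [Function.update_of_ne hj])

theorem agreeOff_self (i : ι) (x : ∀ i, X i) : agreeOff i x x = 1 := by
  simp [agreeOff]

theorem agreeOff_nonneg (i : ι) (x y : ∀ i, X i) : 0 ≤ agreeOff i x y := by
  unfold agreeOff; split_ifs <;> simp

theorem eq_update_of_agreeOff_ne_zero [DecidableEq ι] {i : ι} {x y : ∀ i, X i}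
    (h : agreeOff i x y ≠ 0) : y = Function.update x i (y i) := by
  have h' : ∀ j, j ≠ i → x j = y j := by
    by_contra hc
    exact h (if_neg hc)
  ext j
  rcases eq_or_ne j i with rfl | hj
  · simp
  · rw [Function.update_of_ne hj, h' j hj]

/-- Summation over the states that agree with `x` outside coordinate `i`. -/
theorem hasSum_mul_agreeOff [DecidableEq ι] (i : ι) (x : ∀ i, X i) {g : (∀ i, X i) → ℝ} {a : ℝ}
    (h : HasSum (fun z => g (Function.update x i z)) a) :
    HasSum (fun y => g y * agreeOff i x y) a := by
  rw [← (Function.update_injective x i).hasSum_iff]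
  · refine hasSum_of_eq (fun z => ?_) h
    simp only [Function.comp_apply]
    rw [agreeOff_comm, agreeOff_update_left, agreeOff_self, mul_one]
  · intro y hy
    by_contra hne
    exact hy ⟨y i, (eq_update_of_agreeOff_ne_zero (right_ne_zero_of_mul hne)).symm⟩

end OffDiagonal

section Product

variable {ι : Type} {M : ι → MarkovTriple.{u}}

/-- The matrix `I ⊗ ⋯ ⊗ K_i ⊗ ⋯ ⊗ I`. -/
noncomputable def coordKernel (K : ∀ i, (M i).State → (M i).State → ℝ) (i : ι)
    (x y : ∀ i, (M i).State) : ℝ :=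
  K i (x i) (y i) * agreeOff i x y

theorem hasSum_coordKernel {K : ∀ i, (M i).State → (M i).State → ℝ} {i : ι}
    (hK : ∀ x, HasSum (K i x) 1) (x : ∀ i, (M i).State) : HasSum (coordKernel K i x) 1 := by
  classical
  refine hasSum_mul_agreeOff i x ?_
  simpa using hK (x i)

theorem coordKernel_nonneg {K : ∀ i, (M i).State → (M i).State → ℝ} {i : ι}
    (hK : ∀ x y, 0 ≤ K i x y) (x y : ∀ i, (M i).State) : 0 ≤ coordKernel K i x y :=
  mul_nonneg (hK _ _) (agreeOff_nonneg _ _ _)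

/-- The operator `μ ↦ μ (I ⊗ ⋯ ⊗ K_i ⊗ ⋯ ⊗ I)`. -/
noncomputable def coordOp (h : ∀ i, (M i).IsStationaryChain) (i : ι) :
    SummableSpace (∀ i, (M i).State) →L[ℝ] SummableSpace (∀ i, (M i).State) :=
  rowOp (coordKernel (fun i => (M i).K) i) (coordKernel_nonneg (h i).K_nonneg)
    (hasSum_coordKernel (h i).K_sum)

theorem coordOp_pointMass (h : ∀ i, (M i).IsStationaryChain) (i : ι) (x y : ∀ i, (M i).State) :
    coordOp h i (pointMass x) y = (M i).K (x i) (y i) * agreeOff i x y :=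
  rowOp_pointMass_apply _ _ _ _ _

/-- The embedding of the summable families on coordinate `i` as families on the fibre of `x`. -/
noncomputable def fibreEmb [DecidableEq ι] (i : ι) (x : ∀ i, (M i).State) :
    SummableSpace (M i).State →L[ℝ] SummableSpace (∀ i, (M i).State) :=
  kernelOp (fun z => pointMass (Function.update x i z)) (fun _ => (norm_pointMass _).le)

theorem fibreEmb_apply [DecidableEq ι] (i : ι) (x : ∀ i, (M i).State)
    (v : SummableSpace (M i).State) (y : ∀ i, (M i).State) :
    fibreEmb i x v y = v (y i) * agreeOff i x y := by
  rw [← (hasSum_apply (fibreEmb i x) v y).tsum_eq, tsum_eq_single (y i)]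
  · rw [fibreEmb, kernelOp_pointMass, pointMass_apply]
    congr 1
    split_ifs with h
    · rw [← agreeOff_update_left i x y (y i), h, agreeOff_self]
    · by_contra hne
      exact h (eq_update_of_agreeOff_ne_zero (Ne.symm hne)).symm
  · intro z hz
    rw [fibreEmb, kernelOp_pointMass, pointMass_apply, if_neg, mul_zero]
    rintro rfl
    simp at hz

/-- Motion in coordinate `i` stays in the fibre through `x`, where it is the chain `M i`. This
intertwining lets `comp_exp_smul` compute the exponential on the fibre. -/
theorem coordOp_fibreEmb [DecidableEq ι] (h : ∀ i, (M i).IsStationaryChain) (i : ι)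
    (x : ∀ i, (M i).State) (v : SummableSpace (M i).State) :
    coordOp h i (fibreEmb i x v) = fibreEmb i x ((h i).op v) := by
  have : coordOp h i ∘L fibreEmb i x = fibreEmb i x ∘L (h i).op := ext_pointMass fun z => by
    ext y
    rw [ContinuousLinearMap.comp_apply, ContinuousLinearMap.comp_apply, fibreEmb_apply,
      (h i).op_pointMass]
    conv_lhs => rw [fibreEmb, kernelOp_pointMass]
    rw [coordOp_pointMass, Function.update_self, agreeOff_update_left]
  exact congrArg (fun φ => φ v) this

theorem exp_coordOp_pointMass (h : ∀ i, (M i).IsStationaryChain) (i : ι) (t : ℝ)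
    (x y : ∀ i, (M i).State) :
    NormedSpace.exp (t • (coordOp h i - 1)) (pointMass x) y =
      (M i).heat t (x i) (y i) * agreeOff i x y := by
  classical
  have hx : pointMass x = fibreEmb i x (pointMass (x i)) := by
    rw [fibreEmb, kernelOp_pointMass, Function.update_eq_self]
  rw [(h i).heat_eq, MarkovTriple.IsStationaryChain.heatOp, ← fibreEmb_apply, hx]
  refine congrArg (fun v : SummableSpace (∀ i, (M i).State) => v y)
    (comp_exp_smul (T := (h i).op - 1) (fun v => ?_) t (pointMass (x i)))
  simp [coordOp_fibreEmb]

/-- A move in coordinate `j` followed by one in `i` leaves a single possible intermediate state. The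
resulting formula is symmetric in `i` and `j`, whence commutation. -/
theorem coordOp_mul_pointMass [DecidableEq ι] (h : ∀ i, (M i).IsStationaryChain) {i j : ι}
    (hij : i ≠ j) (x y : ∀ i, (M i).State) :
    (coordOp h i * coordOp h j) (pointMass x) y =
      (M i).K (x i) (y i) * (M j).K (x j) (y j) *
        agreeOff i (Function.update x j (y j)) y := by
  rw [mul_apply_eq_comp, ← (hasSum_apply _ _ y).tsum_eq,
    tsum_eq_single (Function.update x j (y j))]
  · rw [coordOp_pointMass, coordOp_pointMass, agreeOff_comm j, agreeOff_update_left,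
      agreeOff_self, Function.update_self, Function.update_of_ne hij]
    ring
  · intro z hz
    rw [coordOp_pointMass, coordOp_pointMass]
    by_contra hne
    have h1 := eq_update_of_agreeOff_ne_zero (right_ne_zero_of_mul (left_ne_zero_of_mul hne))
    have h2 := eq_update_of_agreeOff_ne_zero (right_ne_zero_of_mul (right_ne_zero_of_mul hne))
    refine hz ?_
    rw [h1]
    congr 1
    rw [h2, Function.update_of_ne hij.symm]

theorem agreeOff_update_comm [DecidableEq ι] {i j : ι} (hij : i ≠ j)
    (x y : ∀ i, (M i).State) :
    agreeOff i (Function.update x j (y j)) y = agreeOff j (Function.update x i (y i)) y := by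
  unfold agreeOff
  congr 1
  refine propext ⟨fun H k hk => ?_, fun H k hk => ?_⟩
  · rcases eq_or_ne k i with rfl | hki
    · simp
    · rw [Function.update_of_ne hki]
      simpa [Function.update_of_ne hk] using H k hki
  · rcases eq_or_ne k j with rfl | hkj
    · simp
    · rw [Function.update_of_ne hkj]
      simpa [Function.update_of_ne hk] using H k hkj

theorem commute_coordOp (h : ∀ i, (M i).IsStationaryChain) (i j : ι) :
    Commute (coordOp h i) (coordOp h j) := by
  classical
  rcases eq_or_ne i j with rfl | hij
  · exact Commute.refl _
  · refine ext_pointMass fun x => ?_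
    ext y
    rw [coordOp_mul_pointMass h hij, coordOp_mul_pointMass h hij.symm, agreeOff_update_comm hij]
    ring

-- Stated for a subset `S` of coordinates so that induction can switch them on one at a time; the
-- indicator freezes the others.
open Classical in
theorem exp_sum_coordOp_pointMass (h : ∀ i, (M i).IsStationaryChain) (s : ι → ℝ) (S : Finset ι)
    (x y : ∀ i, (M i).State) :
    NormedSpace.exp (∑ i ∈ S, s i • (coordOp h i - 1)) (pointMass x) y =
      (∏ i ∈ S, (M i).heat (s i) (x i) (y i)) * if ∀ j, j ∉ S → x j = y j then 1 else 0 := by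
  induction S using Finset.induction_on generalizing y with
  | empty =>
    simp [NormedSpace.exp_zero, pointMass_apply, funext_iff]
  | insert a S ha ih =>
    have hcomm : Commute (s a • (coordOp h a - 1)) (∑ i ∈ S, s i • (coordOp h i - 1)) :=
      Commute.sum_right _ _ _ fun i _ => (((commute_coordOp h a i).sub_left
        (Commute.one_left _)).sub_right (Commute.one_right _) |>.smul_left _).smul_right _
    -- The coordinates in `S` move first and `a` afterwards, so the intermediate state still has `x
    -- a` at `a` and already agrees with `y` elsewhere.
    rw [Finset.sum_insert ha, exp_add_of_commute hcomm, mul_apply_eq_comp,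
      ← (hasSum_apply _ _ y).tsum_eq, tsum_eq_single (Function.update y a (x a))]
    · rw [ih, exp_coordOp_pointMass, agreeOff_update_left, agreeOff_self, Finset.prod_insert ha,
        Function.update_self, mul_one]
      have h1 : ∏ i ∈ S, (M i).heat (s i) (x i) (Function.update y a (x a) i) =
          ∏ i ∈ S, (M i).heat (s i) (x i) (y i) :=
        Finset.prod_congr rfl fun i hi => by
          rw [Function.update_of_ne (ne_of_mem_of_not_mem hi ha)]
      have h2 : (∀ j, j ∉ S → x j = Function.update y a (x a) j) ↔
          ∀ j, j ∉ insert a S → x j = y j := by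
        refine forall_congr' fun j => ?_
        rcases eq_or_ne j a with rfl | hj
        · simp
        · simp [hj]
      rw [h1, if_congr h2 rfl rfl]
      ring
    · intro z hz
      rw [ih, exp_coordOp_pointMass]
      by_contra hne
      have h1 := eq_update_of_agreeOff_ne_zero
        (agreeOff_comm a z y ▸ right_ne_zero_of_mul (right_ne_zero_of_mul hne))
      have h2 := right_ne_zero_of_mul (left_ne_zero_of_mul hne)
      have h3 : x a = z a := by
        by_contra hc
        exact h2 (if_neg fun H => hc (H a ha))
      exact hz (h3 ▸ h1)

variable [Fintype ι]

theorem productChain_K (w : ι → ℝ) (x y : ∀ i, (M i).State) :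
    (productChain M w).K x y = ∑ i, w i * coordKernel (fun i => (M i).K) i x y := by
  simp only [productChain, coordKernel, prod_erase_eq_agreeOff]

theorem hasSum_stat_mul_coordKernel (h : ∀ i, (M i).IsStationaryChain) (i : ι)
    (y : ∀ i, (M i).State) :
    HasSum (fun x : ∀ i, (M i).State => (∏ j, (M j).stat (x j)) *
      coordKernel (fun i => (M i).K) i x y) (∏ j, (M j).stat (y j)) := by
  classical
  have h1 := ((h i).stationary (y i)).mul_left (∏ j ∈ Finset.univ.erase i, (M j).stat (y j))
  rw [Finset.prod_erase_mul _ _ (Finset.mem_univ i)] at h1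
  have h2 := hasSum_mul_agreeOff i y
    (g := fun x => (∏ j, (M j).stat (x j)) * (M i).K (x i) (y i)) (a := ∏ j, (M j).stat (y j))
    (by
      refine hasSum_of_eq (fun z => ?_) h1
      rw [← Finset.prod_erase_mul _ _ (Finset.mem_univ i), Function.update_self, mul_assoc]
      congr 1
      exact Finset.prod_congr rfl fun j hj => by
        rw [Function.update_of_ne (Finset.ne_of_mem_erase hj)])
  refine hasSum_of_eq (fun x => ?_) h2
  simp only [coordKernel, agreeOff_comm i y, mul_assoc]

theorem isStationaryChain_productChain (h : ∀ i, (M i).IsStationaryChain) {w : ι → ℝ}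
    (hw : ∀ i, 0 ≤ w i) (hw1 : ∑ i, w i = 1) (hstat : HasSum (productChain M w).stat 1) :
    (productChain M w).IsStationaryChain where
  K_nonneg x y := (Finset.sum_nonneg fun i _ =>
    mul_nonneg (hw i) (coordKernel_nonneg (h i).K_nonneg x y)).trans_eq (productChain_K w x y).symm
  K_sum x := by
    refine hasSum_of_eq ((productChain_K w x)) ?_
    have := hasSum_sum (s := Finset.univ) fun i _ =>
      (hasSum_coordKernel (K := fun i => (M i).K) (h i).K_sum x).mul_left (w i)
    simp only [mul_one, hw1] at this
    exact this
  stat_nonneg x := Finset.prod_nonneg fun i _ => (h i).stat_nonneg _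
  stat_sum := hstat
  stationary y := by
    have h3 := hasSum_sum (s := Finset.univ) fun i _ =>
      (hasSum_stat_mul_coordKernel h i y).mul_left (w i)
    rw [← Finset.sum_mul, hw1, one_mul] at h3
    refine hasSum_of_eq (fun x => ?_) h3
    refine (congrArg (fun c => (∏ j, (M j).stat (x j)) * c) (productChain_K w x y)).trans ?_
    rw [Finset.mul_sum]
    exact Finset.sum_congr rfl fun i _ => mul_left_comm _ _ _

/-- The heat kernel of a product chain is the product of the time-changed heat kernels. -/
theorem heat_productChain (h : ∀ i, (M i).IsStationaryChain) {w : ι → ℝ}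
    (hw1 : ∑ i, w i = 1) (hP : (productChain M w).IsStationaryChain) (t : ℝ)
    (x y : ∀ i, (M i).State) :
    MarkovTriple.heat (productChain M w) t x y = ∏ i, (M i).heat (w i * t) (x i) (y i) := by
  classical
  have hA : ∀ x y, (∑ i, w i • coordOp h i) (pointMass x) y =
      ∑ i, w i * coordKernel (fun i => (M i).K) i x y := by
    intro x y
    rw [_root_.sum_apply, lp.coeFn_sum, Finset.sum_apply]
    refine Finset.sum_congr rfl fun i _ => ?_
    rw [_root_.smul_apply, lp.coeFn_smul, Pi.smul_apply, smul_eq_mul]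
    exact congrArg _ (coordOp_pointMass h i x y)
  have hop : (hP.op : SummableSpace (∀ i, (M i).State) →L[ℝ] SummableSpace (∀ i, (M i).State)) =
      ∑ i, w i • coordOp h i :=
    ext_pointMass fun x => Subtype.ext <| funext fun y =>
      (hP.op_pointMass x y).trans ((productChain_K w x y).trans (hA x y).symm)
  -- Because the weights sum to one, the identity splits among the coordinates and each generator
  -- gets its own clock `w i * t`.
  have hexp : t • ((∑ i, w i • coordOp h i) - 1) = ∑ i, (w i * t) • (coordOp h i - 1) := by
    simp only [smul_sub, Finset.sum_sub_distrib, ← Finset.sum_smul, ← Finset.sum_mul, hw1,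
      Finset.smul_sum, smul_smul, one_mul, mul_comm t]
  have h1 := exp_sum_coordOp_pointMass h (fun i => w i * t) Finset.univ x y
  rw [← hexp, ← hop] at h1
  refine (hP.heat_eq t x y).trans (h1.trans ?_)
  simp

end Product

/-! ### Tonelli and products of sums. -/

section Sums

variable {α β : Type*}

theorem hasSum_swap {f : α → β → ℝ} (hf : ∀ x y, 0 ≤ f x y) {g : α → ℝ} {G : ℝ}
    (h : ∀ x, HasSum (f x) (g x)) (hg : HasSum g G) :
    (∀ y, Summable fun x => f x y) ∧ HasSum (fun y => ∑' x, f x y) G := by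
  have hs : Summable (fun q : α × β => f q.1 q.2) := by
    rw [summable_prod_of_nonneg fun q => hf _ _]
    refine ⟨fun x => (h x).summable, ?_⟩
    simpa only [fun x => (h x).tsum_eq] using hg.summable
  have hG : HasSum (fun q : α × β => f q.1 q.2) G := by
    have := hs.hasSum.prod_fiberwise h
    rw [hg.unique this]
    exact hs.hasSum
  have hG' : HasSum (fun q : β × α => f q.2 q.1) G := (Equiv.prodComm β α).hasSum_iff.2 hG
  have hsy : ∀ y, Summable fun x => f x y := fun y => hG'.summable.prod_factor y
  exact ⟨hsy, hG'.prod_fiberwise fun y => (hsy y).hasSum⟩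

/-- The sum of a product function over a finite product of index sets. -/
theorem hasSum_prod_pi {n : ℕ} {X : Fin n → Type u} {f : ∀ i, X i → ℝ} (hf : ∀ i x, 0 ≤ f i x)
    {a : Fin n → ℝ} (h : ∀ i, HasSum (f i) (a i)) :
    HasSum (fun x : ∀ i, X i => ∏ i, f i (x i)) (∏ i, a i) := by
  induction n with
  | zero => simp
  | succ n ih =>
    have ih' : HasSum (fun x : ∀ i : Fin n, X i.succ => ∏ i : Fin n, f i.succ (x i))
        (∏ i : Fin n, a i.succ) :=
      ih (fun i x => hf i.succ x) (fun i => h i.succ)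
    have hs := (h 0).summable.mul_of_nonneg ih'.summable (fun x => hf 0 x)
      (fun x => Finset.prod_nonneg fun i _ => hf _ _)
    have h1 := (h 0).mul ih' hs
    rw [Fin.prod_univ_succ, ← (Fin.consEquiv X).hasSum_iff]
    refine hasSum_of_eq (fun q => ?_) h1
    rw [Function.comp_apply, Fin.prod_univ_succ]
    rfl

end Sums

/-! ### Common mass and overlap, for both distances at once. -/

/-- The exponent that turns a distance into one minus an overlap. -/
def Distance.order : Distance → ℕ
  | .totalVariation => 1
  | .hellinger => 2

theorem Distance.rho_eq (δ : Distance) : δ.rho = δ.order := by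
  cases δ <;> simp [Distance.rho, Distance.order]

theorem Distance.order_ne_zero (δ : Distance) : δ.order ≠ 0 := by
  cases δ <;> simp [Distance.order]

/-- The common mass of two masses. -/
noncomputable def Distance.common : Distance → ℝ → ℝ → ℝ
  | .totalVariation, a, b => min a b
  | .hellinger, a, b => √(a * b)

namespace Distance

variable (δ : Distance)

theorem common_nonneg {a b : ℝ} (ha : 0 ≤ a) (hb : 0 ≤ b) : 0 ≤ δ.common a b := by
  cases δ
  · exact le_min ha hb
  · exact Real.sqrt_nonneg _

theorem common_le_add {a b : ℝ} (ha : 0 ≤ a) (hb : 0 ≤ b) : δ.common a b ≤ (a + b) / 2 := by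
  cases δ
  · have h1 := min_le_left a b
    have h2 := min_le_right a b
    change min a b ≤ _
    linarith
  · exact Real.sqrt_le_iff.2 ⟨by positivity, by nlinarith [sq_nonneg (a - b)]⟩

theorem common_mono {a b a' b' : ℝ} (ha : 0 ≤ a) (hb : 0 ≤ b) (haa : a ≤ a') (hbb : b ≤ b') :
    δ.common a b ≤ δ.common a' b' := by
  cases δ
  · exact min_le_min haa hbb
  · exact Real.sqrt_le_sqrt (mul_le_mul haa hbb hb (ha.trans haa))

theorem common_mul_le {a b a' b' : ℝ} (ha : 0 ≤ a) (hb : 0 ≤ b) (ha' : 0 ≤ a') (hb' : 0 ≤ b') :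
    δ.common a b * δ.common a' b' ≤ δ.common (a * a') (b * b') := by
  cases δ
  · exact le_min (mul_le_mul (min_le_left _ _) (min_le_left _ _) (le_min ha' hb') ha)
      (mul_le_mul (min_le_right _ _) (min_le_right _ _) (le_min ha' hb') hb)
  · change √(a * b) * √(a' * b') ≤ √(a * a' * (b * b'))
    rw [← Real.sqrt_mul (by positivity)]
    exact le_of_eq (congrArg _ (by ring))

theorem prod_common_le {ι : Type*} (s : Finset ι) {f g : ι → ℝ} (hf : ∀ i, 0 ≤ f i)
    (hg : ∀ i, 0 ≤ g i) :
    ∏ i ∈ s, δ.common (f i) (g i) ≤ δ.common (∏ i ∈ s, f i) (∏ i ∈ s, g i) := by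
  classical
  induction s using Finset.induction_on with
  | empty => cases δ <;> simp [common]
  | insert a s ha ih =>
    rw [Finset.prod_insert ha, Finset.prod_insert ha, Finset.prod_insert ha]
    exact (mul_le_mul_of_nonneg_left ih (δ.common_nonneg (hf a) (hg a))).trans
      (δ.common_mul_le (hf a) (hg a) (Finset.prod_nonneg fun i _ => hf i)
        (Finset.prod_nonneg fun i _ => hg i))

theorem common_mul_right {a b c : ℝ} (hc : 0 ≤ c) :
    δ.common (a * c) (b * c) = δ.common a b * c := by
  cases δ
  · exact (min_mul_of_nonneg a b hc).symm
  · change √(a * c * (b * c)) = √(a * b) * c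
    rw [show a * c * (b * c) = (a * b) * (c * c) by ring,
      Real.sqrt_mul' _ (mul_self_nonneg c), Real.sqrt_mul_self hc]

/-- For Hellinger this is Cauchy–Schwarz in the plane. Together with the homogeneity
`common_mul_right` it is what makes the overlap monotone under kernels. -/
theorem common_add_le {a b a' b' : ℝ} (ha : 0 ≤ a) (hb : 0 ≤ b) (ha' : 0 ≤ a') (hb' : 0 ≤ b') :
    δ.common a b + δ.common a' b' ≤ δ.common (a + a') (b + b') := by
  cases δ
  · exact le_min (add_le_add (min_le_left _ _) (min_le_left _ _))
      (add_le_add (min_le_right _ _) (min_le_right _ _))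
  · refine Real.le_sqrt_of_sq_le ?_
    have key : (√a * √b + √a' * √b') ^ 2 ≤ (√a ^ 2 + √a' ^ 2) * (√b ^ 2 + √b' ^ 2) := by
      nlinarith [sq_nonneg (√a * √b' - √a' * √b)]
    rw [Real.sq_sqrt ha, Real.sq_sqrt hb, Real.sq_sqrt ha', Real.sq_sqrt hb'] at key
    simpa only [common, Real.sqrt_mul ha, Real.sqrt_mul ha'] using key

theorem sum_common_le {ι : Type*} (s : Finset ι) {f g : ι → ℝ} (hf : ∀ i, 0 ≤ f i)
    (hg : ∀ i, 0 ≤ g i) :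
    ∑ i ∈ s, δ.common (f i) (g i) ≤ δ.common (∑ i ∈ s, f i) (∑ i ∈ s, g i) := by
  classical
  induction s using Finset.induction_on with
  | empty => cases δ <;> simp [common]
  | insert a s ha ih =>
    rw [Finset.sum_insert ha, Finset.sum_insert ha, Finset.sum_insert ha]
    exact (add_le_add_right ih _).trans
      (δ.common_add_le (hf a) (hg a) (Finset.sum_nonneg fun i _ => hf i)
        (Finset.sum_nonneg fun i _ => hg i))

/-- The common mass of two families of masses. -/
noncomputable def overlap {α : Type*} (μ ν : α → ℝ) : ℝ := ∑' y, δ.common (μ y) (ν y)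

variable {α β : Type*} {μ ν : α → ℝ}

theorem summable_common (hμ : ∀ y, 0 ≤ μ y) (hν : ∀ y, 0 ≤ ν y) (hμs : Summable μ)
    (hνs : Summable ν) : Summable fun y => δ.common (μ y) (ν y) :=
  ((hμs.add hνs).div_const 2).of_nonneg_of_le (fun y => δ.common_nonneg (hμ y) (hν y))
    (fun y => δ.common_le_add (hμ y) (hν y))

theorem overlap_nonneg (hμ : ∀ y, 0 ≤ μ y) (hν : ∀ y, 0 ≤ ν y) : 0 ≤ δ.overlap μ ν :=
  tsum_nonneg fun y => δ.common_nonneg (hμ y) (hν y)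

/-- The overlap is at most the common mass of the total masses. -/
theorem overlap_le {A B : ℝ} (hμ : ∀ y, 0 ≤ μ y) (hν : ∀ y, 0 ≤ ν y) (hμs : HasSum μ A)
    (hνs : HasSum ν B) : δ.overlap μ ν ≤ δ.common A B := by
  refine (δ.summable_common hμ hν hμs.summable hνs.summable).tsum_le_of_sum_le fun s => ?_
  refine (δ.sum_common_le s hμ hν).trans ?_
  exact δ.common_mono (Finset.sum_nonneg fun i _ => hμ i) (Finset.sum_nonneg fun i _ => hν i)
    (sum_le_hasSum s (fun i _ => hμ i) hμs) (sum_le_hasSum s (fun i _ => hν i) hνs)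

theorem overlap_le_one (hμ : ∀ y, 0 ≤ μ y) (hν : ∀ y, 0 ≤ ν y) (hμs : HasSum μ 1)
    (hνs : HasSum ν 1) : δ.overlap μ ν ≤ 1 :=
  (δ.overlap_le hμ hν hμs hνs).trans (by cases δ <;> simp [common])

/-- The overlap does not decrease under a stochastic matrix. -/
theorem overlap_le_overlap {P : α → β → ℝ} (hP : ∀ x y, 0 ≤ P x y) (hP1 : ∀ x, HasSum (P x) 1)
    (hμ : ∀ y, 0 ≤ μ y) (hν : ∀ y, 0 ≤ ν y) (hμs : HasSum μ 1) (hνs : HasSum ν 1)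
    {μ' ν' : β → ℝ} (hμ' : ∀ y, HasSum (fun x => μ x * P x y) (μ' y))
    (hν' : ∀ y, HasSum (fun x => ν x * P x y) (ν' y)) :
    δ.overlap μ ν ≤ δ.overlap μ' ν' := by
  have hsum : ∀ {μ : α → ℝ} {μ' : β → ℝ}, (∀ y, 0 ≤ μ y) → HasSum μ 1 →
      (∀ y, HasSum (fun x => μ x * P x y) (μ' y)) → HasSum μ' 1 := by
    intro μ μ' hμ hμs hμ'
    have := (hasSum_swap (fun x y => mul_nonneg (hμ x) (hP x y))
      (fun x => by simpa using (hP1 x).mul_left (μ x)) hμs).2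
    simpa only [fun y => (hμ' y).tsum_eq] using this
  have hnn : ∀ {μ : α → ℝ} {μ' : β → ℝ}, (∀ y, 0 ≤ μ y) →
      (∀ y, HasSum (fun x => μ x * P x y) (μ' y)) → ∀ y, 0 ≤ μ' y := fun hμ hμ' y =>
    (hμ' y).nonneg fun x => mul_nonneg (hμ x) (hP x y)
  have h1 := hasSum_swap
    (f := fun x y => δ.common (μ x) (ν x) * P x y)
    (fun x y => mul_nonneg (δ.common_nonneg (hμ x) (hν x)) (hP x y))
    (fun x => by simpa using (hP1 x).mul_left (δ.common (μ x) (ν x)))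
    (δ.summable_common hμ hν hμs.summable hνs.summable).hasSum
  have h2 := δ.summable_common (hnn hμ hμ') (hnn hν hν') (hsum hμ hμs hμ').summable
    (hsum hν hνs hν').summable
  -- After the interchange of sums the comparison is column by column: homogeneity moves `P x y`
  -- inside the common mass, and superadditivity bounds the sum over `x`.
  refine hasSum_le (fun y => ?_) h1.2 h2.hasSum
  simp only [← δ.common_mul_right (hP _ y)]
  exact δ.overlap_le (fun x => mul_nonneg (hμ x) (hP x y)) (fun x => mul_nonneg (hν x) (hP x y))
    (hμ' y) (hν' y)

end Distance

/-! ### Contraction by kernels whose rows are close to stationarity. -/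

namespace Distance

/-- The pointwise discrepancy of two masses. -/
noncomputable def gap : Distance → ℝ → ℝ → ℝ
  | .totalVariation, a, b => |a - b|
  | .hellinger, a, b => (√a - √b) ^ 2

variable (δ : Distance) {α : Type*} {μ ν : α → ℝ}

theorem gap_nonneg (a b : ℝ) : 0 ≤ δ.gap a b := by
  cases δ
  · exact abs_nonneg _
  · exact sq_nonneg _

theorem gap_eq {a b : ℝ} (ha : 0 ≤ a) (hb : 0 ≤ b) : δ.gap a b = a + b - 2 * δ.common a b := by
  cases δ
  · change |a - b| = a + b - 2 * min a b
    linarith [max_sub_min_eq_abs a b, max_add_min a b, abs_sub_comm a b]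
  · change (√a - √b) ^ 2 = a + b - 2 * √(a * b)
    rw [Real.sqrt_mul ha, sub_sq, Real.sq_sqrt ha, Real.sq_sqrt hb]
    ring

theorem hasSum_gap (hμ : ∀ y, 0 ≤ μ y) (hν : ∀ y, 0 ≤ ν y) (hμs : HasSum μ 1)
    (hνs : HasSum ν 1) :
    HasSum (fun y => δ.gap (μ y) (ν y)) (2 * (1 - δ.overlap μ ν)) := by
  have h := (hμs.add hνs).sub
    ((δ.summable_common hμ hν hμs.summable hνs.summable).hasSum.mul_left 2)
  rw [show 2 * (1 - δ.overlap μ ν) = 1 + 1 - 2 * δ.overlap μ ν by ring]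
  exact hasSum_of_eq (fun y => δ.gap_eq (hμ y) (hν y)) h

/-- The Cauchy–Schwarz inequality for infinite sums of nonnegative terms. -/
theorem tsum_sqrt_mul_le {f g : α → ℝ} {a b : ℝ} (hf : ∀ y, 0 ≤ f y) (hg : ∀ y, 0 ≤ g y)
    (hfs : HasSum f a) (hgs : HasSum g b) :
    (Summable fun y => √(f y * g y)) ∧ ∑' y, √(f y * g y) ≤ √(a * b) :=
  ⟨hellinger.summable_common hf hg hfs.summable hgs.summable,
    hellinger.overlap_le hf hg hfs hgs⟩

theorem sq_tsum_mul_le {f g : α → ℝ} {A B : ℝ} (hf : HasSum (fun y => f y ^ 2) A)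
    (hg : HasSum (fun y => g y ^ 2) B) : (∑' y, f y * g y) ^ 2 ≤ A * B := by
  have h := tsum_sqrt_mul_le (fun y => sq_nonneg (f y)) (fun y => sq_nonneg (g y)) hf hg
  have hA : 0 ≤ A := hf.nonneg fun y => sq_nonneg _
  have hB : 0 ≤ B := hg.nonneg fun y => sq_nonneg _
  have he : ∀ y, √(f y ^ 2 * g y ^ 2) = ‖f y * g y‖ := fun y => by
    rw [← mul_pow, Real.sqrt_sq_eq_abs, Real.norm_eq_abs]
  simp only [he] at h
  have h1 : |∑' y, f y * g y| ≤ √(A * B) := (norm_tsum_le_tsum_norm h.1).trans h.2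
  rw [← sq_abs, ← Real.sq_sqrt (mul_nonneg hA hB)]
  exact pow_le_pow_left₀ (abs_nonneg _) h1 2

/-- The sum of squares that enters the Hellinger contraction estimate. -/
theorem tsum_sq_mul_sq_le {Q : α → ℝ} {c n : ℝ} (hQ : ∀ y, 0 ≤ Q y)
    (hμ : ∀ y, 0 ≤ μ y) (hν : ∀ y, 0 ≤ ν y) (hμs : HasSum μ 1) (hνs : HasSum ν 1)
    (hc : HasSum (fun y => μ y * Q y) c) (hn : HasSum (fun y => ν y * Q y) n) :
    ∃ B, HasSum (fun y => ((√(μ y) + √(ν y)) * (√(Q y) + √n)) ^ 2) B ∧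
      B ≤ 8 * (√c + √n) ^ 2 := by
  have hn0 : 0 ≤ n := hn.nonneg fun y => mul_nonneg (hν y) (hQ y)
  have hc0 : 0 ≤ c := hc.nonneg fun y => mul_nonneg (hμ y) (hQ y)
  have hμQ := fun y => mul_nonneg (hμ y) (hQ y)
  have hνQ := fun y => mul_nonneg (hν y) (hQ y)
  obtain ⟨s1, e1⟩ := tsum_sqrt_mul_le hμ hμQ hμs hc
  obtain ⟨s2, e2⟩ := tsum_sqrt_mul_le hν hνQ hνs hn
  obtain ⟨s3, e3⟩ := tsum_sqrt_mul_le hμQ hνQ hc hn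
  obtain ⟨s4, e4⟩ := tsum_sqrt_mul_le hμ hν hμs hνs
  obtain ⟨s5, e5⟩ := tsum_sqrt_mul_le hν hμQ hνs hc
  rw [one_mul] at e1 e2 e5
  rw [mul_one, Real.sqrt_one] at e4
  rw [Real.sqrt_mul hc0] at e3
  -- The square expands into four sums known exactly and five mixed ones; Cauchy–Schwarz on the
  -- latter bounds the total by `c + 7 * n + 8 * √(c * n)`, which is at most `8 * (√c + √n) ^ 2`.
  have hB := (((((((hc.add (hμs.mul_right n)).add hn).add (hνs.mul_right n)).add
    (s1.hasSum.mul_left (2 * √n))).add (s2.hasSum.mul_left (2 * √n))).add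
    (s3.hasSum.mul_left 2)).add (s4.hasSum.mul_left (2 * n))).add (s5.hasSum.mul_left (4 * √n))
  refine ⟨_, hasSum_of_eq (fun y => ?_) hB, ?_⟩
  · have q1 : √(μ y * (μ y * Q y)) = √(μ y) ^ 2 * √(Q y) := by
      rw [Real.sqrt_mul (hμ y), Real.sqrt_mul (hμ y)]; ring
    have q2 : √(ν y * (ν y * Q y)) = √(ν y) ^ 2 * √(Q y) := by
      rw [Real.sqrt_mul (hν y), Real.sqrt_mul (hν y)]; ring
    have q3 : √(μ y * Q y * (ν y * Q y)) = √(μ y) * √(ν y) * √(Q y) ^ 2 := by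
      rw [Real.sqrt_mul (hμQ y), Real.sqrt_mul (hμ y), Real.sqrt_mul (hν y)]; ring
    have q4 : √(μ y * ν y) = √(μ y) * √(ν y) := Real.sqrt_mul (hμ y) _
    have q5 : √(ν y * (μ y * Q y)) = √(ν y) * √(μ y) * √(Q y) := by
      rw [Real.sqrt_mul (hν y), Real.sqrt_mul (hμ y)]; ring
    rw [q1, q2, q3, q4, q5]
    have m1 := Real.sq_sqrt (hμ y)
    have m2 := Real.sq_sqrt (hν y)
    have m3 := Real.sq_sqrt (hQ y)
    have m4 := Real.sq_sqrt hn0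
    generalize √(μ y) = a at *
    generalize √(ν y) = b at *
    generalize √(Q y) = d at *
    generalize √n = e at *
    rw [← m1, ← m2, ← m3, ← m4]
    ring
  · have p1 := Real.sq_sqrt hc0
    have p2 := Real.sq_sqrt hn0
    have p3 := Real.sqrt_nonneg c
    have p4 := Real.sqrt_nonneg n
    have f1 := mul_le_mul_of_nonneg_left e1 p4
    have f2 := mul_le_mul_of_nonneg_left e2 p4
    have f4 := mul_le_mul_of_nonneg_left e4 hn0
    have f5 := mul_le_mul_of_nonneg_left e5 p4
    nlinarith

/-- As `μ` and `ν` both have mass one, `c - n` is the sum of `(μ - ν) * (Q - n)`. For total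
variation the triangle inequality suffices. For Hellinger, write both factors as differences of
squares of roots, apply Cauchy–Schwarz, and cancel `(√c + √n) ^ 2`; the constant is `8 = 4 ^ 2 / 2`.
-/
theorem gap_mix_le {Q : α → ℝ} {c n : ℝ} (hQ : ∀ y, 0 ≤ Q y)
    (hμ : ∀ y, 0 ≤ μ y) (hν : ∀ y, 0 ≤ ν y) (hμs : HasSum μ 1) (hνs : HasSum ν 1)
    (hc : HasSum (fun y => μ y * Q y) c) (hn : HasSum (fun y => ν y * Q y) n)
    (hs : Summable fun y => δ.gap (μ y) (ν y) * δ.gap (Q y) n) :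
    δ.gap c n ≤ (2 * δ.rho) ^ δ.order / 2 * ∑' y, δ.gap (μ y) (ν y) * δ.gap (Q y) n := by
  have hn0 : 0 ≤ n := hn.nonneg fun y => mul_nonneg (hν y) (hQ y)
  have hc0 : 0 ≤ c := hc.nonneg fun y => mul_nonneg (hμ y) (hQ y)
  have hsigned : HasSum (fun y => (μ y - ν y) * (Q y - n)) (c - n) := by
    have h := (hc.sub hn).sub ((hμs.sub hνs).mul_right n)
    rw [sub_self, zero_mul, sub_zero] at h
    refine hasSum_of_eq (fun y => ?_) h
    ring
  cases δ
  · simp only [rho, order, gap, ← abs_mul] at hs ⊢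
    have h := norm_tsum_le_tsum_norm (f := fun y => (μ y - ν y) * (Q y - n))
      (by simpa only [Real.norm_eq_abs] using hs)
    rw [hsigned.tsum_eq] at h
    norm_num only [one_mul] at h ⊢
    simpa only [Real.norm_eq_abs] using h
  · simp only [rho, order, gap, ← mul_pow] at hs ⊢
    obtain ⟨B, hB, hB8⟩ := tsum_sq_mul_sq_le hQ hμ hν hμs hνs hc hn
    have h1 := sq_tsum_mul_le (f := fun y => (√(μ y) - √(ν y)) * (√(Q y) - √n))
      (g := fun y => (√(μ y) + √(ν y)) * (√(Q y) + √n)) hs.hasSum hB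
    have h2 : ∑' y, (√(μ y) - √(ν y)) * (√(Q y) - √n) *
        ((√(μ y) + √(ν y)) * (√(Q y) + √n)) = c - n := by
      rw [← hsigned.tsum_eq]
      refine tsum_congr fun y => ?_
      have m1 := Real.sq_sqrt (hμ y)
      have m2 := Real.sq_sqrt (hν y)
      have m3 := Real.sq_sqrt (hQ y)
      have m4 := Real.sq_sqrt hn0
      calc _ = (√(μ y) ^ 2 - √(ν y) ^ 2) * (√(Q y) ^ 2 - √n ^ 2) := by ring
        _ = _ := by rw [m1, m2, m3, m4]
    rw [h2] at h1
    have h3 : c - n = (√c - √n) * (√c + √n) := by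
      nlinarith [Real.sq_sqrt hc0, Real.sq_sqrt hn0]
    have hS : 0 ≤ ∑' y, ((√(μ y) - √(ν y)) * (√(Q y) - √n)) ^ 2 := tsum_nonneg fun y => sq_nonneg _
    have h4 : (√c - √n) ^ 2 * (√c + √n) ^ 2 ≤
        (8 * ∑' y, ((√(μ y) - √(ν y)) * (√(Q y) - √n)) ^ 2) * (√c + √n) ^ 2 := by
      rw [← mul_pow, ← h3]
      nlinarith [mul_le_mul_of_nonneg_left hB8 hS]
    rw [show (2 * 2 : ℝ) ^ 2 / 2 = 8 by norm_num]
    rcases (add_nonneg (Real.sqrt_nonneg c) (Real.sqrt_nonneg n)).eq_or_lt with h0 | h0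
    · have hc' : √c = 0 := by linarith [Real.sqrt_nonneg c, Real.sqrt_nonneg n]
      have hn' : √n = 0 := by linarith [Real.sqrt_nonneg c, Real.sqrt_nonneg n]
      have : (√c - √n) ^ 2 = 0 := by rw [hc', hn']; norm_num
      rw [this]
      positivity
    · exact le_of_mul_le_mul_right h4 (by positivity)

/-- A stochastic matrix all of whose rows are close to its stationary probability contracts. -/
theorem one_sub_overlap_le {P : α → α → ℝ} {D : ℝ} (hP : ∀ x y, 0 ≤ P x y)
    (hP1 : ∀ x, HasSum (P x) 1) (hμ : ∀ y, 0 ≤ μ y) (hν : ∀ y, 0 ≤ ν y) (hμs : HasSum μ 1)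
    (hνs : HasSum ν 1) (hνP : ∀ y, HasSum (fun x => ν x * P x y) (ν y)) {μ' : α → ℝ}
    (hμ's : HasSum μ' 1)
    (hμ' : ∀ y, HasSum (fun x => μ x * P x y) (μ' y)) (hD : ∀ x, 1 - δ.overlap (P x) ν ≤ D) :
    1 - δ.overlap μ' ν ≤ (2 * δ.rho) ^ δ.order * ((1 - δ.overlap μ ν) * D) := by
  have hgμ := δ.hasSum_gap hμ hν hμs hνs
  have hg : ∀ y, HasSum (fun z => δ.gap (μ y) (ν y) * δ.gap (P y z) (ν z))
      (δ.gap (μ y) (ν y) * (2 * (1 - δ.overlap (P y) ν))) := fun y =>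
    (δ.hasSum_gap (hP y) hν (hP1 y) hνs).mul_left _
  have hle : ∀ y, δ.gap (μ y) (ν y) * (2 * (1 - δ.overlap (P y) ν)) ≤
      δ.gap (μ y) (ν y) * (2 * D) := fun y =>
    mul_le_mul_of_nonneg_left (by linarith [hD y]) (δ.gap_nonneg _ _)
  have hnn : ∀ y z, 0 ≤ δ.gap (μ y) (ν y) * δ.gap (P y z) (ν z) := fun y z =>
    mul_nonneg (δ.gap_nonneg _ _) (δ.gap_nonneg _ _)
  have hGs : Summable fun y => δ.gap (μ y) (ν y) * (2 * (1 - δ.overlap (P y) ν)) :=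
    (hgμ.summable.mul_right (2 * D)).of_nonneg_of_le (fun y => (hg y).nonneg (hnn y)) hle
  have hG : ∑' y, δ.gap (μ y) (ν y) * (2 * (1 - δ.overlap (P y) ν)) ≤
      2 * (1 - δ.overlap μ ν) * (2 * D) :=
    hasSum_le hle hGs.hasSum (hgμ.mul_right _)
  obtain ⟨hs, hsum⟩ := hasSum_swap hnn hg hGs.hasSum
  have h1 := hasSum_le
    (fun z => δ.gap_mix_le (fun y => hP y z) hμ hν hμs hνs (hμ' z) (hνP z) (hs z))
    (δ.hasSum_gap (fun y => (hμ' y).nonneg fun x => mul_nonneg (hμ x) (hP x y)) hν hμ's hνs)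
    (hsum.mul_left ((2 * δ.rho) ^ δ.order / 2))
  have hρ : 0 ≤ (2 * δ.rho) ^ δ.order := by
    rw [δ.rho_eq]; positivity
  nlinarith [mul_le_mul_of_nonneg_left hG hρ]

end Distance

/-! ### The maximum distance of one chain. -/

section TotalVariation

variable {α : Type*} {μ ν : α → ℝ}

theorem tsum_subtype_sub_le (hμ : ∀ y, 0 ≤ μ y) (hν : ∀ y, 0 ≤ ν y) (hμs : HasSum μ 1)
    (hνs : HasSum ν 1) (A : Set α) :
    (∑' y : A, μ y) - ∑' y : A, ν y ≤ 1 - Distance.totalVariation.overlap μ ν := by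
  have hs := Distance.totalVariation.summable_common hμ hν hμs.summable hνs.summable
  rw [tsum_subtype, tsum_subtype, ← hμs.tsum_eq]
  refine hasSum_le (fun y => ?_) ((hμs.summable.indicator A).hasSum.sub
    (hνs.summable.indicator A).hasSum) (hμs.summable.hasSum.sub hs.hasSum)
  change _ ≤ μ y - min (μ y) (ν y)
  by_cases hy : y ∈ A
  · rw [Set.indicator_of_mem hy, Set.indicator_of_mem hy]
    linarith [min_le_right (μ y) (ν y)]
  · rw [Set.indicator_of_notMem hy, Set.indicator_of_notMem hy]
    linarith [min_le_left (μ y) (ν y)]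

/-- The set where `μ` dominates is optimal, so the bound of `tsum_subtype_sub_le` is attained. -/
theorem tsum_subtype_sub_eq (hμ : ∀ y, 0 ≤ μ y) (hν : ∀ y, 0 ≤ ν y) (hμs : HasSum μ 1)
    (hνs : HasSum ν 1) :
    (∑' y : {y | ν y ≤ μ y}, μ y) - ∑' y : {y | ν y ≤ μ y}, ν y =
      1 - Distance.totalVariation.overlap μ ν := by
  have hs := Distance.totalVariation.summable_common hμ hν hμs.summable hνs.summable
  rw [tsum_subtype, tsum_subtype, ← hμs.tsum_eq]
  refine ((hμs.summable.indicator _).hasSum.sub (hνs.summable.indicator _).hasSum).unique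
    (hasSum_of_eq (fun y => ?_) (hμs.summable.hasSum.sub hs.hasSum))
  change _ = μ y - min (μ y) (ν y)
  by_cases hy : y ∈ {y | ν y ≤ μ y}
  · rw [Set.indicator_of_mem hy, Set.indicator_of_mem hy, min_eq_right hy]
  · rw [Set.indicator_of_notMem hy, Set.indicator_of_notMem hy,
      min_eq_left (not_le.1 hy).le]
    simp

end TotalVariation

namespace MarkovTriple.IsStationaryChain

variable {M : MarkovTriple.{u}}

theorem nonempty (h : M.IsStationaryChain) : Nonempty M.State := by
  by_contra hc
  rw [not_nonempty_iff] at hc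
  exact zero_ne_one (hasSum_empty.unique h.stat_sum)

theorem overlap_nonneg (h : M.IsStationaryChain) {t : ℝ} (ht : 0 ≤ t) (δ : Distance)
    (x : M.State) : 0 ≤ δ.overlap (M.heat t x) M.stat :=
  δ.overlap_nonneg (h.heat_nonneg ht x) h.stat_nonneg

theorem overlap_le_one (h : M.IsStationaryChain) {t : ℝ} (ht : 0 ≤ t) (δ : Distance)
    (x : M.State) : δ.overlap (M.heat t x) M.stat ≤ 1 :=
  δ.overlap_le_one (h.heat_nonneg ht x) h.stat_nonneg (h.heat_hasSum t x) h.stat_sum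

theorem dH_eq (h : M.IsStationaryChain) {t : ℝ} (ht : 0 ≤ t) :
    M.dH t = ⨆ x, √(1 - Distance.hellinger.overlap (M.heat t x) M.stat) := by
  unfold MarkovTriple.dH
  refine congrArg _ (funext fun x => congrArg _ ?_)
  have := (Distance.hellinger.hasSum_gap (h.heat_nonneg ht x) h.stat_nonneg (h.heat_hasSum t x)
    h.stat_sum).tsum_eq
  change ∑' y, (√(M.heat t x y) - √(M.stat y)) ^ 2 = _ at this
  rw [this]
  ring

theorem maxDist_nonneg (h : M.IsStationaryChain) {t : ℝ} (ht : 0 ≤ t) (δ : Distance) :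
    0 ≤ maxDist δ M t := by
  cases δ
  · obtain ⟨x⟩ := h.nonempty
    refine le_ciSup_of_le ⟨1, ?_⟩ (x, ∅) (by simp)
    rintro _ ⟨q, rfl⟩
    refine (tsum_subtype_sub_le (h.heat_nonneg ht q.1) h.stat_nonneg (h.heat_hasSum t q.1)
      h.stat_sum q.2).trans ?_
    linarith [h.overlap_nonneg ht .totalVariation q.1]
  · exact Real.iSup_nonneg fun x => Real.sqrt_nonneg _

theorem one_sub_overlap_le_pow (h : M.IsStationaryChain) {t : ℝ} (ht : 0 ≤ t) (δ : Distance)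
    (x : M.State) : 1 - δ.overlap (M.heat t x) M.stat ≤ maxDist δ M t ^ δ.order := by
  cases δ
  · rw [Distance.order, pow_one, ← tsum_subtype_sub_eq (h.heat_nonneg ht x) h.stat_nonneg
      (h.heat_hasSum t x) h.stat_sum]
    refine le_ciSup_of_le (f := fun q : M.State × Set M.State =>
      (∑' y : q.2, M.heat t q.1 y) - ∑' y : q.2, M.stat y) ⟨1, ?_⟩ (x, _) le_rfl
    rintro _ ⟨q, rfl⟩
    refine (tsum_subtype_sub_le (h.heat_nonneg ht q.1) h.stat_nonneg (h.heat_hasSum t q.1)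
      h.stat_sum q.2).trans ?_
    linarith [h.overlap_nonneg ht .totalVariation q.1]
  · have h1 : 0 ≤ 1 - Distance.hellinger.overlap (M.heat t x) M.stat := by
      linarith [h.overlap_le_one ht .hellinger x]
    change _ ≤ M.dH t ^ 2
    rw [← Real.sq_sqrt h1, h.dH_eq ht]
    refine pow_le_pow_left₀ (Real.sqrt_nonneg _) ?_ 2
    refine le_ciSup (f := fun x => √(1 - Distance.hellinger.overlap (M.heat t x) M.stat))
      ⟨1, ?_⟩ x
    rintro _ ⟨x, rfl⟩
    refine Real.sqrt_le_one.2 ?_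
    linarith [h.overlap_nonneg ht .hellinger x]

theorem maxDist_pow_le (h : M.IsStationaryChain) {t : ℝ} (ht : 0 ≤ t) (δ : Distance) {c : ℝ}
    (hc : ∀ x, 1 - δ.overlap (M.heat t x) M.stat ≤ c) : maxDist δ M t ^ δ.order ≤ c := by
  obtain ⟨x⟩ := h.nonempty
  have hc0 : 0 ≤ c := by linarith [hc x, h.overlap_le_one ht δ x]
  cases δ
  · rw [Distance.order, pow_one]
    have : Nonempty (M.State × Set M.State) := ⟨(x, ∅)⟩
    exact ciSup_le fun q => (tsum_subtype_sub_le (h.heat_nonneg ht q.1) h.stat_nonneg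
      (h.heat_hasSum t q.1) h.stat_sum q.2).trans (hc q.1)
  · have := h.nonempty
    change M.dH t ^ 2 ≤ c
    rw [h.dH_eq ht, ← Real.sq_sqrt hc0]
    exact pow_le_pow_left₀ (Real.iSup_nonneg fun x => Real.sqrt_nonneg _)
      (ciSup_le fun x => Real.sqrt_le_sqrt (hc x)) 2

theorem maxDist_le_of_pow_le (h : M.IsStationaryChain) {t : ℝ} (ht : 0 ≤ t) (δ : Distance) {c : ℝ}
    (hc0 : 0 ≤ c) (hc : ∀ x, 1 - δ.overlap (M.heat t x) M.stat ≤ c ^ δ.order) :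
    maxDist δ M t ≤ c :=
  (pow_le_pow_iff_left₀ (h.maxDist_nonneg ht δ) hc0 δ.order_ne_zero).1 (h.maxDist_pow_le ht δ hc)

theorem maxDist_le_one (h : M.IsStationaryChain) {t : ℝ} (ht : 0 ≤ t) (δ : Distance) :
    maxDist δ M t ≤ 1 :=
  h.maxDist_le_of_pow_le ht δ zero_le_one fun x => by
    rw [one_pow]; linarith [h.overlap_nonneg ht δ x]

/-- Running the chain for the extra time `t - s` applies a kernel that fixes `π`, and kernels do not
decrease the overlap. -/
theorem maxDist_anti (h : M.IsStationaryChain) (δ : Distance) {s t : ℝ} (hs : 0 ≤ s)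
    (hst : s ≤ t) : maxDist δ M t ≤ maxDist δ M s := by
  refine h.maxDist_le_of_pow_le (hs.trans hst) δ (h.maxDist_nonneg hs δ) fun x => ?_
  have h1 := δ.overlap_le_overlap (h.heat_nonneg (sub_nonneg.2 hst)) (h.heat_hasSum (t - s))
    (h.heat_nonneg hs x) h.stat_nonneg (h.heat_hasSum s x) h.stat_sum
    (fun y => h.heat_add s (t - s) x y) (h.heat_stationary (t - s))
  rw [add_sub_cancel] at h1
  change _ ≤ δ.overlap (M.heat t x) M.stat at h1
  linarith [h.one_sub_overlap_le_pow hs δ x]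

/-- Submultiplicativity of the maximum distance, up to the constant `2ϱ`. -/
theorem maxDist_add_le (h : M.IsStationaryChain) (δ : Distance) {s t : ℝ} (hs : 0 ≤ s)
    (ht : 0 ≤ t) : maxDist δ M (s + t) ≤ 2 * δ.rho * (maxDist δ M s * maxDist δ M t) := by
  have hρ : 0 ≤ 2 * δ.rho := by rw [δ.rho_eq]; positivity
  refine h.maxDist_le_of_pow_le (add_nonneg hs ht) δ (mul_nonneg hρ
    (mul_nonneg (h.maxDist_nonneg hs δ) (h.maxDist_nonneg ht δ))) fun x => ?_
  refine (δ.one_sub_overlap_le (h.heat_nonneg ht) (h.heat_hasSum t) (h.heat_nonneg hs x)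
    h.stat_nonneg (h.heat_hasSum s x) h.stat_sum (h.heat_stationary t) (h.heat_hasSum (s + t) x)
    (fun y => h.heat_add s t x y) (h.one_sub_overlap_le_pow ht δ)).trans ?_
  rw [mul_pow (2 * δ.rho) (_ * _), mul_pow (maxDist δ M s)]
  exact mul_le_mul_of_nonneg_left (mul_le_mul_of_nonneg_right (h.one_sub_overlap_le_pow hs δ x)
    (pow_nonneg (h.maxDist_nonneg ht δ) _)) (pow_nonneg hρ _)

theorem maxDist_nat_mul_le (h : M.IsStationaryChain) (δ : Distance) {t : ℝ} (ht : 0 ≤ t) (k : ℕ) :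
    2 * δ.rho * maxDist δ M ((k + 1 : ℕ) * t) ≤ (2 * δ.rho * maxDist δ M t) ^ (k + 1) := by
  have hρ : 0 ≤ 2 * δ.rho := by rw [δ.rho_eq]; positivity
  induction k with
  | zero => simp
  | succ k ih =>
    have h1 := h.maxDist_add_le δ (s := ((k + 1 : ℕ) : ℝ) * t) (by positivity) ht
    rw [show ((k + 1 + 1 : ℕ) : ℝ) * t = ((k + 1 : ℕ) : ℝ) * t + t by push_cast; ring, pow_succ]
    calc _ ≤ 2 * δ.rho * (2 * δ.rho * (maxDist δ M ((k + 1 : ℕ) * t) * maxDist δ M t)) :=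
          mul_le_mul_of_nonneg_left h1 hρ
      _ = 2 * δ.rho * maxDist δ M ((k + 1 : ℕ) * t) * (2 * δ.rho * maxDist δ M t) := by ring
      _ ≤ _ := mul_le_mul_of_nonneg_right ih (mul_nonneg hρ (h.maxDist_nonneg ht δ))

end MarkovTriple.IsStationaryChain

/-! ### Distance of a product against the distances of its factors. -/

section Product

variable {n : ℕ} {M : Fin n → MarkovTriple.{u}} {w : Fin n → ℝ}

theorem hasSum_prod_pi_one {X : Fin n → Type u} {f : ∀ i, X i → ℝ} (hf : ∀ i x, 0 ≤ f i x)
    (h : ∀ i, HasSum (f i) 1) : HasSum (fun x : ∀ i, X i => ∏ i, f i (x i)) 1 := by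
  simpa using hasSum_prod_pi hf h

theorem isStationaryChain_finProduct (h : ∀ i, (M i).IsStationaryChain) (hw : ∀ i, 0 ≤ w i)
    (hw1 : ∑ i, w i = 1) : (productChain M w).IsStationaryChain :=
  isStationaryChain_productChain h hw hw1
    (hasSum_prod_pi_one (fun i => (h i).stat_nonneg) fun i => (h i).stat_sum)

theorem hasSum_marginal {X : Fin n → Type u} {μ : ∀ i, X i → ℝ} (hμ : ∀ i x, 0 ≤ μ i x)
    (hμ1 : ∀ i, HasSum (μ i) 1) (i : Fin n) [DecidableEq (X i)]
    (z : X i) :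
    HasSum (fun y : ∀ i, X i => (∏ j, μ j (y j)) * if y i = z then 1 else 0) (μ i z) := by
  -- The constraint `y i = z` is absorbed into factor `i`, so the sum is again one of a product
  -- function.
  set g : ∀ j, X j → ℝ := Function.update μ i (fun w => μ i w * if w = z then 1 else 0) with hg
  have hgi : g i = fun w => μ i w * if w = z then 1 else 0 := Function.update_self _ _ _
  have hgj : ∀ j, j ≠ i → g j = μ j := fun j hj => Function.update_of_ne hj _ _
  have h1 := hasSum_prod_pi (f := g) (a := Function.update (fun _ => 1) i (μ i z))
    (fun j x => by
      rcases eq_or_ne j i with rfl | hj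
      · rw [hgi]; exact mul_nonneg (hμ _ _) (by split_ifs <;> simp)
      · rw [hgj j hj]; exact hμ _ _)
    (fun j => by
      rcases eq_or_ne j i with rfl | hj
      · rw [hgi, Function.update_self]
        convert hasSum_single z (f := fun w => μ j w * if w = z then 1 else 0) ?_ using 1
        · simp
        · intro w hw; simp [hw]
      · rw [hgj j hj, Function.update_of_ne hj]; exact hμ1 j)
  rw [← Finset.mul_prod_erase _ _ (Finset.mem_univ i), Function.update_self,
    Finset.prod_eq_one (fun j hj => Function.update_of_ne (Finset.ne_of_mem_erase hj) _ _),
    mul_one] at h1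
  refine hasSum_of_eq (fun y => ?_) h1
  rw [← Finset.mul_prod_erase _ (fun j => μ j (y j)) (Finset.mem_univ i),
    ← Finset.mul_prod_erase _ (fun j => g j (y j)) (Finset.mem_univ i), hgi,
    Finset.prod_congr (f := fun j => g j (y j)) (g := fun j => μ j (y j)) rfl fun j hj => by
      rw [hgj j (Finset.ne_of_mem_erase hj)]]
  ring

/-- Projecting to a coordinate does not decrease the overlap. -/
theorem overlap_prod_le (δ : Distance) {X : Fin n → Type u} {μ ν : ∀ i, X i → ℝ}
    (hμ : ∀ i x, 0 ≤ μ i x) (hν : ∀ i x, 0 ≤ ν i x) (hμ1 : ∀ i, HasSum (μ i) 1)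
    (hν1 : ∀ i, HasSum (ν i) 1) (i : Fin n) :
    δ.overlap (fun y : ∀ i, X i => ∏ j, μ j (y j)) (fun y => ∏ j, ν j (y j)) ≤
      δ.overlap (μ i) (ν i) := by
  classical
  refine δ.overlap_le_overlap (P := fun (y : ∀ i, X i) z => if y i = z then 1 else 0)
    (fun y z => by split_ifs <;> simp) (fun y => ?_)
    (fun y => Finset.prod_nonneg fun j _ => hμ _ _) (fun y => Finset.prod_nonneg fun j _ => hν _ _)
    (hasSum_prod_pi_one hμ hμ1) (hasSum_prod_pi_one hν hν1)
    (hasSum_marginal hμ hμ1 i) (hasSum_marginal hν hν1 i)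
  convert hasSum_single (y i) (f := fun z => if y i = z then (1 : ℝ) else 0) ?_ using 1
  · simp
  · intro z hz; simp [hz.symm]

/-- The overlap of product masses is at least the product of the overlaps. -/
theorem prod_overlap_le (δ : Distance) {X : Fin n → Type u} {μ ν : ∀ i, X i → ℝ}
    (hμ : ∀ i x, 0 ≤ μ i x) (hν : ∀ i x, 0 ≤ ν i x) (hμ1 : ∀ i, HasSum (μ i) 1)
    (hν1 : ∀ i, HasSum (ν i) 1) :
    ∏ i, δ.overlap (μ i) (ν i) ≤
      δ.overlap (fun y : ∀ i, X i => ∏ j, μ j (y j)) (fun y => ∏ j, ν j (y j)) := by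
  have hs : Summable fun y : ∀ i, X i => δ.common (∏ j, μ j (y j)) (∏ j, ν j (y j)) :=
    δ.summable_common (fun y => Finset.prod_nonneg fun j _ => hμ j (y j))
      (fun y => Finset.prod_nonneg fun j _ => hν j (y j)) (hasSum_prod_pi_one hμ hμ1).summable
      (hasSum_prod_pi_one hν hν1).summable
  have hc : ∀ i, HasSum (fun x => δ.common (μ i x) (ν i x)) (δ.overlap (μ i) (ν i)) := fun i =>
    (δ.summable_common (hμ i) (hν i) (hμ1 i).summable (hν1 i).summable).hasSum
  have hp : HasSum (fun y : ∀ i, X i => ∏ i, δ.common (μ i (y i)) (ν i (y i)))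
      (∏ i, δ.overlap (μ i) (ν i)) :=
    hasSum_prod_pi (f := fun i x => δ.common (μ i x) (ν i x))
      (fun i x => δ.common_nonneg (hμ i x) (hν i x)) hc
  have hle : ∀ y : ∀ i, X i, ∏ i, δ.common (μ i (y i)) (ν i (y i)) ≤
      δ.common (∏ j, μ j (y j)) (∏ j, ν j (y j)) := fun y =>
    δ.prod_common_le Finset.univ (fun i => hμ i (y i)) fun i => hν i (y i)
  exact hasSum_le hle hp hs.hasSum

theorem overlap_productChain (h : ∀ i, (M i).IsStationaryChain) (hw : ∀ i, 0 ≤ w i)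
    (hw1 : ∑ i, w i = 1) (δ : Distance) (t : ℝ) (x : ∀ i, (M i).State) :
    δ.overlap (MarkovTriple.heat (productChain M w) t x) (productChain M w).stat =
      δ.overlap (fun y : ∀ i, (M i).State => ∏ j, (M j).heat (w j * t) (x j) (y j))
        (fun y => ∏ j, (M j).stat (y j)) :=
  congrArg (fun f => δ.overlap (α := ∀ i, (M i).State) f (productChain M w).stat)
    (funext fun y => heat_productChain h hw1 (isStationaryChain_finProduct h hw hw1) t x y)

/-- Complete a starting point of factor `i` arbitrarily to one of the product, then project. -/
theorem maxDist_le_maxDist_productChain (h : ∀ i, (M i).IsStationaryChain) (hw : ∀ i, 0 ≤ w i)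
    (hw1 : ∑ i, w i = 1) (δ : Distance) {t : ℝ} (ht : 0 ≤ t) (i : Fin n) :
    maxDist δ (M i) (w i * t) ≤ maxDist δ (productChain M w) t := by
  have hP := isStationaryChain_finProduct h hw hw1
  have hwt := fun i => mul_nonneg (hw i) ht
  refine (h i).maxDist_le_of_pow_le (hwt i) δ (hP.maxDist_nonneg ht δ) fun z => ?_
  have x₀ : ∀ j, (M j).State := fun j => (h j).nonempty.some
  have h1 := hP.one_sub_overlap_le_pow ht δ (Function.update x₀ i z)
  rw [overlap_productChain h hw hw1] at h1
  have h2 := overlap_prod_le δ (fun j => (h j).heat_nonneg (hwt j) (Function.update x₀ i z j))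
    (fun j => (h j).stat_nonneg) (fun j => (h j).heat_hasSum _ _) (fun j => (h j).stat_sum) i
  rw [Function.update_self] at h2
  exact (sub_le_sub_left h2 1).trans h1

theorem maxDist_productChain_pow_le (h : ∀ i, (M i).IsStationaryChain) (hw : ∀ i, 0 ≤ w i)
    (hw1 : ∑ i, w i = 1) (δ : Distance) {t : ℝ} (ht : 0 ≤ t) :
    maxDist δ (productChain M w) t ^ δ.order ≤
      1 - ∏ i, (1 - maxDist δ (M i) (w i * t) ^ δ.order) := by
  have hP := isStationaryChain_finProduct h hw hw1
  have hwt := fun i => mul_nonneg (hw i) ht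
  refine hP.maxDist_pow_le ht δ fun x => ?_
  refine sub_le_sub_left (le_trans ?_ ((prod_overlap_le δ
    (fun j => (h j).heat_nonneg (hwt j) (x j)) (fun j => (h j).stat_nonneg)
    (fun j => (h j).heat_hasSum _ _) (fun j => (h j).stat_sum)).trans_eq
      (overlap_productChain h hw hw1 δ t x).symm)) 1
  refine Finset.prod_le_prod (fun i _ => ?_) fun i _ => ?_
  · exact sub_nonneg.2 (pow_le_one₀ ((h i).maxDist_nonneg (hwt i) δ)
      ((h i).maxDist_le_one (hwt i) δ))
  · linarith [(h i).one_sub_overlap_le_pow (hwt i) δ (x i)]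

end Product

section Real

theorem Distance.pow_order_le_self (δ : Distance) {x : ℝ} (h0 : 0 ≤ x) (h1 : x ≤ 1) :
    x ^ δ.order ≤ x :=
  pow_le_of_le_one h0 h1 δ.order_ne_zero

/-- For order two, `2 * x ≤ 1 + x ^ 2`. The point is that a bound below 1 on the power gives one
below 1 on the distance. -/
theorem Distance.le_of_pow_order_le (δ : Distance) {x B : ℝ} (h : x ^ δ.order ≤ B) (hB : B ≤ 1) :
    x ≤ (1 + B) / 2 := by
  cases δ
  · rw [Distance.order, pow_one] at h; linarith
  · rw [Distance.order] at h; nlinarith [sq_nonneg (x - 1)]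

theorem one_sub_sum_le_prod {ι : Type*} (s : Finset ι) {x : ι → ℝ} (h0 : ∀ i, 0 ≤ x i)
    (h1 : ∀ i, x i ≤ 1) : 1 - ∑ i ∈ s, x i ≤ ∏ i ∈ s, (1 - x i) := by
  classical
  induction s using Finset.induction_on with
  | empty => simp
  | insert a s ha ih =>
    rw [Finset.sum_insert ha, Finset.prod_insert ha]
    have := Finset.sum_nonneg fun i (_ : i ∈ s) => h0 i
    nlinarith [mul_le_mul_of_nonneg_left ih (sub_nonneg.2 (h1 a)), mul_nonneg (h0 a) this]

theorem tendsto_zero_of_eventually_le {f : ℕ → ℝ} (h0 : ∀ᶠ n in atTop, 0 ≤ f n)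
    (h : ∀ ε > 0, ∀ᶠ n in atTop, f n ≤ ε) : Tendsto f atTop (𝓝 0) := by
  refine tendsto_order.2 ⟨fun b hb => h0.mono fun n hn => hb.trans_le hn, fun b hb => ?_⟩
  exact (h (b / 2) (half_pos hb)).mono fun n hn => hn.trans_lt (half_lt_self hb)

end Real

/-! ### Reference times: where a cutoff has to occur. -/

section Reference

/-- The sequence `σ` separates times at which the distance is bounded away from `0` from times at
which it is bounded away from `1`. -/
structure IsReference (δ : Distance) (G : ℕ → MarkovTriple.{u}) (σ : ℕ → ℝ) : Prop where
  chain : ∀ n, (G n).IsStationaryChain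
  pos : ∀ᶠ n in atTop, 0 < σ n
  lower : ∀ a : ℝ, 0 < a → a < 1 → ∃ e > 0, ∀ᶠ n in atTop, e ≤ maxDist δ (G n) (a * σ n)
  upper : ∀ a : ℝ, 1 < a → ∃ e < 1, ∀ᶠ n in atTop, maxDist δ (G n) (a * σ n) ≤ e

variable {δ : Distance} {G : ℕ → MarkovTriple.{u}} {σ t : ℕ → ℝ}

/-- Otherwise, for some `a > 1` with `a * θ < 1`, the time `a * σ n` would precede `a * θ * t n`,
where the distance tends to 1, against `upper`. -/
theorem IsReference.mul_le (h : IsReference δ G σ) (ht : IsCutoffTime δ G t) {θ : ℝ} (hθ0 : 0 < θ)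
    (hθ : θ < 1) : ∀ᶠ n in atTop, θ * t n ≤ σ n := by
  obtain ⟨a, ha, haθ⟩ := exists_between ((one_lt_inv₀ hθ0).2 hθ)
  have ha0 : 0 < a := zero_lt_one.trans ha
  obtain ⟨e, he, hup⟩ := h.upper a ha
  have haθ1 : a * θ < 1 := by
    rw [← inv_mul_cancel₀ hθ0.ne']; exact mul_lt_mul_of_pos_right haθ hθ0
  filter_upwards [hup, h.pos, (tendsto_order.1 (ht.2.2 (a * θ) (mul_pos ha0 hθ0) haθ1)).1 e he]
    with n h1 h2 h3
  by_contra! hc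
  refine absurd (h3.trans_le ((h.chain n).maxDist_anti δ (mul_pos ha0 h2).le ?_)) (not_lt.2 h1)
  rw [mul_assoc]
  exact mul_le_mul_of_nonneg_left hc.le ha0.le

theorem IsReference.le_mul (h : IsReference δ G σ) (ht : IsCutoffTime δ G t) {θ : ℝ}
    (hθ : 1 < θ) : ∀ᶠ n in atTop, σ n ≤ θ * t n := by
  have hθ0 : 0 < θ := zero_lt_one.trans hθ
  obtain ⟨a, haθ, ha⟩ := exists_between (inv_lt_one_of_one_lt₀ hθ)
  have ha0 : 0 < a := (inv_pos.2 hθ0).trans haθ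
  obtain ⟨e, he, hlow⟩ := h.lower a ha0 ha
  have haθ1 : 1 < a * θ := (inv_lt_iff_one_lt_mul₀ hθ0).1 haθ
  filter_upwards [hlow, (tendsto_order.1 (ht.2.1 (a * θ) haθ1)).2 e he] with n h1 h3
  by_contra! hc
  refine absurd (h1.trans ((h.chain n).maxDist_anti δ
    (mul_pos (mul_pos ha0 hθ0) (ht.1 n)).le ?_)) (not_le.2 h3)
  rw [mul_assoc]
  exact mul_le_mul_of_nonneg_left hc.le ha0.le

theorem IsReference.tendsto_zero (h : IsReference δ G σ) (hG : HasCutoff δ G) {a : ℝ}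
    (ha : 1 < a) : Tendsto (fun n => maxDist δ (G n) (a * σ n)) atTop (𝓝 0) := by
  obtain ⟨t, ht⟩ := hG
  have ha0 : 0 < a := zero_lt_one.trans ha
  obtain ⟨θ, hθ1, hθ⟩ := exists_between (inv_lt_one_of_one_lt₀ ha)
  have hθ0 : 0 < θ := (inv_pos.2 ha0).trans hθ1
  have haθ : 1 < a * θ := (inv_lt_iff_one_lt_mul₀' ha0).1 hθ1
  refine squeeze_zero' (h.pos.mono fun n hn => (h.chain n).maxDist_nonneg (mul_pos ha0 hn).le δ) ?_
    (ht.2.1 (a * θ) haθ)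
  filter_upwards [h.mul_le ht hθ0 hθ] with n hn
  refine (h.chain n).maxDist_anti δ (mul_pos (mul_pos ha0 hθ0) (ht.1 n)).le ?_
  rw [mul_assoc]
  exact mul_le_mul_of_nonneg_left hn ha0.le

theorem IsReference.tendsto_one (h : IsReference δ G σ) (hG : HasCutoff δ G) {a : ℝ}
    (ha0 : 0 < a) (ha : a < 1) : Tendsto (fun n => maxDist δ (G n) (a * σ n)) atTop (𝓝 1) := by
  obtain ⟨t, ht⟩ := hG
  obtain ⟨θ, hθ, hθ1⟩ := exists_between ((one_lt_inv₀ ha0).2 ha)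
  have hθ0 : 0 < θ := zero_lt_one.trans hθ
  have haθ : a * θ < 1 := by
    rw [← mul_inv_cancel₀ ha0.ne']; exact mul_lt_mul_of_pos_left hθ1 ha0
  refine tendsto_of_tendsto_of_tendsto_of_le_of_le' (ht.2.2 (a * θ) (mul_pos ha0 hθ0) haθ)
    tendsto_const_nhds ?_
    (h.pos.mono fun n hn => (h.chain n).maxDist_le_one (mul_pos ha0 hn).le δ)
  filter_upwards [h.le_mul ht hθ, h.pos] with n hn h2
  refine (h.chain n).maxDist_anti δ (mul_pos ha0 h2).le ?_
  rw [mul_assoc]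
  exact mul_le_mul_of_nonneg_left hn ha0.le

theorem hasCutoff_of_tendsto (hpos : ∀ᶠ n in atTop, 0 < σ n)
    (h0 : ∀ a : ℝ, 1 < a → Tendsto (fun n => maxDist δ (G n) (a * σ n)) atTop (𝓝 0))
    (h1 : ∀ a : ℝ, 0 < a → a < 1 → Tendsto (fun n => maxDist δ (G n) (a * σ n)) atTop (𝓝 1)) :
    HasCutoff δ G := by
  have he : ∀ a : ℝ, (fun n => maxDist δ (G n) (a * σ n)) =ᶠ[atTop]
      fun n => maxDist δ (G n) (a * if 0 < σ n then σ n else 1) := fun a =>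
    hpos.mono fun n hn => by simp only [if_pos hn]
  -- A cutoff time must be positive for every `n`; the value 1 fills in the finitely many
  -- exceptions.
  refine ⟨fun n => if 0 < σ n then σ n else 1, fun n => ?_, fun a ha => (h0 a ha).congr' (he a),
    fun a ha ha' => (h1 a ha ha').congr' (he a)⟩
  dsimp only
  split_ifs with h
  · exact h
  · exact one_pos

theorem IsCutoffTime.comp (h : IsCutoffTime δ G t) {ξ : ℕ → ℕ} (hξ : StrictMono ξ) :
    IsCutoffTime δ (G ∘ ξ) (t ∘ ξ) :=
  ⟨fun _ => h.1 _, fun a ha => (h.2.1 a ha).comp hξ.tendsto_atTop,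
    fun a ha ha' => (h.2.2 a ha ha').comp hξ.tendsto_atTop⟩

end Reference

/-! ### The family of products, on the common clock `s`. -/

section ProductFamily

variable {δ : Distance} {F : ℕ → MarkovTriple.{u}} {p : ℕ → ℝ}

theorem partialSum_pos (hp : ∀ n, 0 < p n) (n : ℕ) : 0 < partialSum p n :=
  Finset.sum_pos (fun i _ => hp i) ⟨0, by simp⟩

theorem weights_nonneg (hp : ∀ n, 0 < p n) (n : ℕ) (i : Fin (n + 1)) :
    0 ≤ p i / partialSum p n :=
  (div_pos (hp _) (partialSum_pos hp n)).le

theorem sum_weights (hp : ∀ n, 0 < p n) (n : ℕ) :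
    ∑ i : Fin (n + 1), p i / partialSum p n = 1 := by
  rw [← Finset.sum_div, Fin.sum_univ_eq_sum_range]
  exact div_self (partialSum_pos hp n).ne'

theorem isStationaryChain_productFamily (hF : ∀ n, (F n).IsStationaryChain) (hp : ∀ n, 0 < p n)
    (n : ℕ) : (productFamily F p n).IsStationaryChain :=
  isStationaryChain_finProduct (fun i => hF i) (weights_nonneg hp n) (sum_weights hp n)

theorem maxDist_le_maxDist_productFamily (hF : ∀ n, (F n).IsStationaryChain)
    (hp : ∀ n, 0 < p n) (δ : Distance) (n : ℕ) {s : ℝ} (hs : 0 ≤ s) :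
    maxDist δ (F n) (p n * s) ≤ maxDist δ (productFamily F p n) (partialSum p n * s) := by
  have hq := partialSum_pos hp n
  have h := maxDist_le_maxDist_productChain (fun i : Fin (n + 1) => hF i) (weights_nonneg hp n)
    (sum_weights hp n) δ (mul_nonneg hq.le hs) (Fin.last n)
  rw [← mul_assoc, div_mul_cancel₀ _ hq.ne'] at h
  exact h

theorem maxDist_productFamily_pow_le (hF : ∀ n, (F n).IsStationaryChain) (hp : ∀ n, 0 < p n)
    (δ : Distance) (n : ℕ) {s : ℝ} (hs : 0 ≤ s) :
    maxDist δ (productFamily F p n) (partialSum p n * s) ^ δ.order ≤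
      1 - ∏ i ∈ Finset.range (n + 1), (1 - maxDist δ (F i) (p i * s) ^ δ.order) := by
  have hq := partialSum_pos hp n
  have h := maxDist_productChain_pow_le (fun i : Fin (n + 1) => hF i) (weights_nonneg hp n)
    (sum_weights hp n) δ (mul_nonneg hq.le hs)
  simp only [← mul_assoc, div_mul_cancel₀ _ hq.ne'] at h
  rw [← Fin.prod_univ_eq_prod_range (fun i => 1 - maxDist δ (F i) (p i * s) ^ δ.order)]
  exact h

end ProductFamily

/-! ### Regular families: transfer of cutoffs to and from products. -/

/-- A family with scaled mixing times `S` that are eventually positive and monotone, and such that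
the early chains are mixed at the times `a * S n` for `a > c`. -/
structure IsRegular (δ : Distance) (F : ℕ → MarkovTriple.{u}) (p S : ℕ → ℝ) (c : ℝ) : Prop where
  chain : ∀ n, (F n).IsStationaryChain
  p_pos : ∀ n, 0 < p n
  pos : ∀ᶠ n in atTop, 0 < S n
  mono : ∀ᶠ n in atTop, ∀ i ≤ n, S i ≤ S n
  lower : ∃ e > 0, ∀ n t, 0 ≤ t → t < p n * S n → e ≤ maxDist δ (F n) t
  upper : ∃ e < 1, ∀ n t, 0 ≤ t → p n * S n < t → maxDist δ (F n) t ≤ e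
  tail : ∀ a, c < a → ∀ η > 0, ∃ m : ℕ, ∀ᶠ n in atTop,
    ∑ i ∈ Finset.range (n + 1 - m), maxDist δ (F i) (p i * (a * S n)) ^ δ.order ≤ η

namespace IsRegular

variable {δ : Distance} {F : ℕ → MarkovTriple.{u}} {p S : ℕ → ℝ} {c : ℝ}

/-- The same `m` serves the subfamily: strict monotonicity gives `ξ i + m ≤ ξ n` when `i + m ≤ n`,
so its tail sum is part of the original one at index `ξ n`. -/
theorem comp (h : IsRegular δ F p S c) (hc : 0 < c) {ξ : ℕ → ℕ} (hξ : StrictMono ξ) :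
    IsRegular δ (F ∘ ξ) (p ∘ ξ) (S ∘ ξ) c where
  chain n := h.chain _
  p_pos n := h.p_pos _
  pos := hξ.tendsto_atTop.eventually h.pos
  mono := (hξ.tendsto_atTop.eventually h.mono).mono fun n hn i hi => hn _ (hξ.monotone hi)
  lower := h.lower.imp fun e he => ⟨he.1, fun n => he.2 _⟩
  upper := h.upper.imp fun e he => ⟨he.1, fun n => he.2 _⟩
  tail a ha η hη := by
    obtain ⟨m, hm⟩ := h.tail a ha η hη
    refine ⟨m, ?_⟩
    filter_upwards [hξ.tendsto_atTop.eventually hm, hξ.tendsto_atTop.eventually h.pos] with n hn hp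
    refine le_trans ?_ hn
    simp only [Function.comp_apply]
    rw [← Finset.sum_image (s := Finset.range (n + 1 - m)) (g := ξ)
      (f := fun i => maxDist δ (F i) (p i * (a * S (ξ n))) ^ δ.order) hξ.injective.injOn]
    refine Finset.sum_le_sum_of_subset_of_nonneg (fun j hj => ?_) fun i _ _ =>
      pow_nonneg ((h.chain i).maxDist_nonneg (mul_nonneg (h.p_pos i).le
        (mul_nonneg (hc.trans ha).le hp.le)) δ) _
    obtain ⟨i, hi, rfl⟩ := Finset.mem_image.1 hj
    rw [Finset.mem_range] at hi ⊢
    have h1 : i + m ≤ n := by omega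
    have h2 := hξ.add_le_nat m i
    rw [add_comm m i] at h2
    have h3 := hξ.monotone h1
    omega

theorem isReference (h : IsRegular δ F p S c) : IsReference δ F (fun n => p n * S n) where
  chain := h.chain
  pos := h.pos.mono fun n hn => mul_pos (h.p_pos n) hn
  lower a ha0 ha := by
    obtain ⟨e, he, hlow⟩ := h.lower
    refine ⟨e, he, h.pos.mono fun n hn => hlow n _ ?_ ?_⟩
    · exact (mul_pos ha0 (mul_pos (h.p_pos n) hn)).le
    · exact mul_lt_of_lt_one_left (mul_pos (h.p_pos n) hn) ha
  upper a ha := by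
    obtain ⟨e, he, hup⟩ := h.upper
    refine ⟨e, he, h.pos.mono fun n hn => hup n _ ?_ ?_⟩
    · exact (mul_pos (zero_lt_one.trans ha) (mul_pos (h.p_pos n) hn)).le
    · exact lt_mul_of_one_lt_left (mul_pos (h.p_pos n) hn) ha

theorem chain_product (h : IsRegular δ F p S c) (n : ℕ) :
    (productFamily F p n).IsStationaryChain :=
  isStationaryChain_productFamily h.chain h.p_pos n

theorem maxDist_le_product (h : IsRegular δ F p S c) {a : ℝ} (ha : 0 < a) {n : ℕ} (hn : 0 < S n) :
    maxDist δ (F n) (a * (p n * S n)) ≤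
      maxDist δ (productFamily F p n) (a * (partialSum p n * S n)) := by
  rw [mul_left_comm, mul_left_comm a]
  exact maxDist_le_maxDist_productFamily h.chain h.p_pos δ n (mul_pos ha hn).le

/-- The distance of the product is controlled by the distances of finitely many late chains. -/
theorem product_pow_le (h : IsRegular δ F p S c) (hc : 0 < c) {a η : ℝ} (ha : c < a) (hη : 0 < η)
    (hη1 : η ≤ 1) : ∃ m : ℕ, ∀ κ : ℝ, 0 ≤ κ → κ ≤ 1 →
      (∀ᶠ i in atTop, maxDist δ (F i) (a * (p i * S i)) ^ δ.order ≤ κ) →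
      ∀ᶠ n in atTop, maxDist δ (productFamily F p n) (a * (partialSum p n * S n)) ^ δ.order ≤
        1 - (1 - η) * (1 - κ) ^ m := by
  have ha0 : 0 < a := hc.trans ha
  obtain ⟨m, hm⟩ := h.tail a ha η hη
  refine ⟨m, fun κ hκ0 hκ1 hκ => ?_⟩
  obtain ⟨N₁, hN₁⟩ := eventually_atTop.1 (hκ.and h.pos)
  filter_upwards [hm, h.pos, h.mono, eventually_ge_atTop (N₁ + m)] with n h1 h2 h3 h4
  have hnn : ∀ i, 0 ≤ p i * (a * S n) := fun i => mul_nonneg (h.p_pos i).le (mul_pos ha0 h2).le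
  have hx0 : ∀ i, 0 ≤ maxDist δ (F i) (p i * (a * S n)) ^ δ.order := fun i =>
    pow_nonneg ((h.chain i).maxDist_nonneg (hnn i) δ) _
  have hx1 : ∀ i, maxDist δ (F i) (p i * (a * S n)) ^ δ.order ≤ 1 := fun i =>
    pow_le_one₀ ((h.chain i).maxDist_nonneg (hnn i) δ) ((h.chain i).maxDist_le_one (hnn i) δ)
  rw [mul_left_comm]
  refine (maxDist_productFamily_pow_le h.chain h.p_pos δ n (mul_pos ha0 h2).le).trans ?_
  refine sub_le_sub_left ?_ 1
  -- Early factors are handled by the tail bound. The last `m` indices exceed the threshold for `κ`,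
  -- and since `S i ≤ S n` these chains have run at least `a * (p i * S i)`.
  rw [← Finset.prod_range_mul_prod_Ico _ (Nat.sub_le (n + 1) m)]
  have hA : 1 - η ≤ ∏ i ∈ Finset.range (n + 1 - m),
      (1 - maxDist δ (F i) (p i * (a * S n)) ^ δ.order) :=
    (sub_le_sub_left h1 1).trans (one_sub_sum_le_prod _ hx0 hx1)
  have hB : (1 - κ) ^ m ≤ ∏ i ∈ Finset.Ico (n + 1 - m) (n + 1),
      (1 - maxDist δ (F i) (p i * (a * S n)) ^ δ.order) := by
    have hcard : (Finset.Ico (n + 1 - m) (n + 1)).card = m := by rw [Nat.card_Ico]; omega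
    refine (congrArg (fun k => (1 - κ) ^ k) hcard).symm.le.trans ?_
    rw [← Finset.prod_const]
    refine Finset.prod_le_prod (fun _ _ => sub_nonneg.2 hκ1) fun i hi => sub_le_sub_left ?_ 1
    rw [Finset.mem_Ico] at hi
    obtain ⟨hi1, hi2⟩ := hN₁ i (by omega)
    refine le_trans (pow_le_pow_left₀ ((h.chain i).maxDist_nonneg (hnn i) δ)
      ((h.chain i).maxDist_anti δ ?_ ?_) _) hi1
    · exact mul_nonneg ha0.le (mul_pos (h.p_pos i) hi2).le
    · rw [mul_left_comm]
      exact mul_le_mul_of_nonneg_left (mul_le_mul_of_nonneg_left (h3 i (by omega)) ha0.le)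
        (h.p_pos i).le
  exact mul_le_mul hA hB (pow_nonneg (sub_nonneg.2 hκ1) _) ((sub_nonneg.2 hη1).trans hA)

theorem isReference_product (h : IsRegular δ F p S c) (hc : 0 < c) (hc1 : c < 1) :
    IsReference δ (productFamily F p) (fun n => partialSum p n * S n) where
  chain := h.chain_product
  pos := h.pos.mono fun n hn => mul_pos (partialSum_pos h.p_pos n) hn
  lower a ha0 ha := by
    obtain ⟨e, he, hlow⟩ := h.isReference.lower a ha0 ha
    refine ⟨e, he, ?_⟩
    filter_upwards [hlow, h.pos] with n h1 h2
    exact h1.trans (h.maxDist_le_product ha0 h2)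
  upper a ha := by
    obtain ⟨e, he, hup⟩ := h.isReference.upper a ha
    obtain ⟨m, hm⟩ := h.product_pow_le hc (hc1.trans ha) (η := 1 / 2) (by norm_num) (by norm_num)
    have ha0 : 0 < a := zero_lt_one.trans ha
    have hnn := h.isReference.pos.mono fun n hn =>
      (h.chain n).maxDist_nonneg (mul_pos ha0 hn).le δ
    have he0 : 0 ≤ e := by
      obtain ⟨n, h1, h2⟩ := (hup.and hnn).exists
      exact h2.trans h1
    have hB := hm e he0 he.le (by
      filter_upwards [hup, hnn, h.isReference.pos] with i h1 h2 h3
      exact (δ.pow_order_le_self h2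
        ((h.chain i).maxDist_le_one (mul_pos ha0 h3).le δ)).trans h1)
    have hpow : 0 < (1 - e) ^ m := pow_pos (sub_pos.2 he) m
    refine ⟨(1 + (1 - (1 - 1 / 2) * (1 - e) ^ m)) / 2, by linarith, ?_⟩
    filter_upwards [hB] with n h1
    exact δ.le_of_pow_order_le h1 (by linarith)

theorem product_tendsto_zero (h : IsRegular δ F p S c) (hc : 0 < c) {a : ℝ} (ha : c < a)
    (h0 : Tendsto (fun n => maxDist δ (F n) (a * (p n * S n))) atTop (𝓝 0)) :
    Tendsto (fun n => maxDist δ (productFamily F p n) (a * (partialSum p n * S n)))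
      atTop (𝓝 0) := by
  have ha0 : 0 < a := hc.trans ha
  have hnn := h.pos.mono fun n hn => (h.chain_product n).maxDist_nonneg
    (mul_pos ha0 (mul_pos (partialSum_pos h.p_pos n) hn)).le δ
  refine tendsto_zero_of_eventually_le hnn fun ε hε => ?_
  have hε' : 0 < ε ^ δ.order := pow_pos hε _
  obtain ⟨m, hm⟩ := h.product_pow_le hc ha (η := min (ε ^ δ.order / 2) 1)
    (lt_min (half_pos hε') one_pos) (min_le_right _ _)
  -- `m` depends on `η` only, so `κ` may be chosen after it; Bernoulli then bounds the loss from the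
  -- late chains by `m * κ ≤ ε ^ δ.order / 2`.
  set κ := min (ε ^ δ.order / (2 * (m + 1))) 1 with hκ
  have hκ0 : 0 < κ := lt_min (by positivity) one_pos
  have hκ1 : κ ≤ 1 := min_le_right _ _
  have h1 := hm κ hκ0.le hκ1 (by
    filter_upwards [(tendsto_order.1 h0).2 κ hκ0, h.isReference.pos] with i h1 h2
    have h3 := (mul_pos ha0 h2).le
    exact (δ.pow_order_le_self ((h.chain i).maxDist_nonneg h3 δ)
      ((h.chain i).maxDist_le_one h3 δ)).trans h1.le)
  filter_upwards [h1, hnn] with n hn h2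
  refine (pow_le_pow_iff_left₀ h2 hε.le δ.order_ne_zero).1 (hn.trans ?_)
  have hb : 1 - m * κ ≤ (1 - κ) ^ m := by
    simpa [sub_eq_add_neg] using one_add_mul_le_pow (a := -κ) (by linarith) m
  have hmκ : m * κ ≤ ε ^ δ.order / 2 := by
    have : κ * (2 * (m + 1)) ≤ ε ^ δ.order := by
      rw [← le_div_iff₀ (by positivity)]; exact min_le_left _ _
    nlinarith
  have hη : min (ε ^ δ.order / 2) 1 ≤ ε ^ δ.order / 2 := min_le_left _ _
  have hη0 : 0 ≤ min (ε ^ δ.order / 2) 1 := le_min (half_pos hε').le zero_le_one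
  have hp1 : (1 - κ) ^ m ≤ 1 := pow_le_one₀ (by linarith) (by linarith)
  nlinarith [mul_le_mul_of_nonneg_left hp1 hη0]

/-- A cutoff time for the family yields one for the products. -/
theorem isCutoffTime_product (h : IsRegular δ F p S c) (hc : 0 < c) (hc1 : c < 1) {t : ℕ → ℝ}
    (ht : IsCutoffTime δ F t) :
    IsCutoffTime δ (productFamily F p) (fun n => partialSum p n * t n / p n) := by
  have hq := partialSum_pos h.p_pos
  have htp : ∀ n, 0 < partialSum p n * t n / p n := fun n =>
    div_pos (mul_pos (hq n) (ht.1 n)) (h.p_pos n)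
  refine ⟨htp, fun a ha => ?_, fun a ha0 ha => ?_⟩
  · have ha0 : 0 < a := zero_lt_one.trans ha
    obtain ⟨b, hb1, hba⟩ := exists_between ha
    have hb0 : 0 < b := zero_lt_one.trans hb1
    have h0 := h.product_tendsto_zero hc (hc1.trans hb1)
      (h.isReference.tendsto_zero ⟨t, ht⟩ hb1)
    refine squeeze_zero' (Eventually.of_forall fun n =>
      (h.chain_product n).maxDist_nonneg (mul_pos ha0 (htp n)).le δ) ?_ h0
    -- The room between `b` and `a` absorbs the mismatch of reference and cutoff time: `p n * S n ≤
    -- (a / b) * t n`.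
    filter_upwards [h.isReference.le_mul ht ((one_lt_div hb0).2 hba), h.pos] with n h1 h2
    refine (h.chain_product n).maxDist_anti δ (mul_pos hb0 (mul_pos (hq n) h2)).le ?_
    rw [div_mul_eq_mul_div, le_div_iff₀ hb0] at h1
    rw [mul_div_assoc, mul_left_comm, mul_left_comm a]
    refine mul_le_mul_of_nonneg_left ?_ (hq n).le
    rw [← mul_div_assoc, le_div_iff₀ (h.p_pos n)]
    linarith
  · refine tendsto_of_tendsto_of_tendsto_of_le_of_le (ht.2.2 a ha0 ha) tendsto_const_nhds
      (fun n => ?_) fun n => (h.chain_product n).maxDist_le_one (mul_pos ha0 (htp n)).le δ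
    have h1 := maxDist_le_maxDist_productFamily h.chain h.p_pos δ n (s := a * t n / p n)
      (div_pos (mul_pos ha0 (ht.1 n)) (h.p_pos n)).le
    rw [mul_div_cancel₀ _ (h.p_pos n).ne'] at h1
    refine h1.trans_eq (congrArg _ ?_)
    ring

/-- Along a sparse subsequence, a cutoff of the products forces the last chain far from
stationarity just before the reference time. -/
theorem exists_sparse (h : IsRegular δ F p S c) (hc : 0 < c) (hc1 : c < 1) {a : ℝ} (ha : c < a)
    (ha1 : a < 1) : ∃ ψ : ℕ → ℕ, StrictMono ψ ∧
      (HasCutoff δ (productFamily (F ∘ ψ) (p ∘ ψ)) →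
        Tendsto (fun n => maxDist δ (F (ψ n)) (a * (p (ψ n) * S (ψ n)))) atTop (𝓝 1)) := by
  have ha0 : 0 < a := hc.trans ha
  obtain ⟨m, hm⟩ := h.tail a ha (1 / 2) (by norm_num)
  -- With steps of length `m + 1` every earlier chosen index falls in the range of the tail sum.
  have hψ : StrictMono fun j => (m + 1) * j := fun i j hij =>
    Nat.mul_lt_mul_of_pos_left hij m.succ_pos
  refine ⟨fun j => (m + 1) * j, hψ, fun hcut => ?_⟩
  set ψ : ℕ → ℕ := fun j => (m + 1) * j with hψdef
  have h' := h.comp hc hψ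
  have hD := (h'.isReference_product hc hc1).tendsto_one hcut ha0 ha1
  have hDo := hD.pow δ.order
  rw [one_pow] at hDo
  -- The earlier factors keep overlap product at least 1/2, so `D ^ ϱ ≤ 1 - (1 - d ^ ϱ) / 2`, which
  -- is solved for `d ^ ϱ`.
  have hlow : Tendsto (fun n => 1 - 2 * (1 - maxDist δ (productFamily (F ∘ ψ) (p ∘ ψ) n)
      (a * (partialSum (p ∘ ψ) n * (S ∘ ψ) n)) ^ δ.order)) atTop (𝓝 1) := by
    simpa using ((hDo.const_sub 1).const_mul 2).const_sub 1
  refine tendsto_of_tendsto_of_tendsto_of_le_of_le' hlow tendsto_const_nhds ?_ ?_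
  · filter_upwards [hψ.tendsto_atTop.eventually hm, h'.pos] with n h1 h2
    have hnn : ∀ i, 0 ≤ p i * (a * S (ψ n)) := fun i =>
      mul_nonneg (h.p_pos i).le (mul_pos ha0 h2).le
    have hx0 : ∀ i, 0 ≤ maxDist δ (F i) (p i * (a * S (ψ n))) ^ δ.order := fun i =>
      pow_nonneg ((h.chain i).maxDist_nonneg (hnn i) δ) _
    have hx1 : ∀ i, maxDist δ (F i) (p i * (a * S (ψ n))) ^ δ.order ≤ 1 := fun i =>
      pow_le_one₀ ((h.chain i).maxDist_nonneg (hnn i) δ) ((h.chain i).maxDist_le_one (hnn i) δ)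
    have h3 := maxDist_productFamily_pow_le h'.chain h'.p_pos δ n (mul_pos ha0 h2).le
    rw [Finset.prod_range_succ, mul_left_comm] at h3
    have h4 : ∑ j ∈ Finset.range n, maxDist δ (F (ψ j)) (p (ψ j) * (a * S (ψ n))) ^ δ.order ≤
        1 / 2 := by
      refine le_trans ?_ h1
      rw [← Finset.sum_image (s := Finset.range n) (g := ψ)
        (f := fun i => maxDist δ (F i) (p i * (a * S (ψ n))) ^ δ.order) hψ.injective.injOn]
      refine Finset.sum_le_sum_of_subset_of_nonneg (fun j hj => ?_) fun i _ _ => hx0 i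
      obtain ⟨i, hi, rfl⟩ := Finset.mem_image.1 hj
      rw [Finset.mem_range] at hi ⊢
      have h5 : (m + 1) * (i + 1) ≤ (m + 1) * n := Nat.mul_le_mul_left _ hi
      rw [mul_add, mul_one] at h5
      simp only [hψdef]
      omega
    have h5 := one_sub_sum_le_prod (Finset.range n)
      (x := fun j => maxDist δ (F (ψ j)) (p (ψ j) * (a * S (ψ n))) ^ δ.order)
      (fun j => hx0 _) (fun j => hx1 _)
    have h6 := δ.pow_order_le_self ((h.chain (ψ n)).maxDist_nonneg (hnn (ψ n)) δ)
      ((h.chain (ψ n)).maxDist_le_one (hnn (ψ n)) δ)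
    have h7 := mul_le_mul_of_nonneg_right (h5.trans' (sub_le_sub_left h4 1))
      (sub_nonneg.2 (hx1 (ψ n)))
    simp only [Function.comp_apply] at h3 ⊢
    rw [mul_left_comm] at h6
    rw [mul_left_comm a (p (ψ n))] at *
    linarith
  · exact h'.isReference.pos.mono fun n hn =>
      (h.chain _).maxDist_le_one (mul_pos ha0 hn).le δ

theorem hasCutoff_of_product (h : IsRegular δ F p S c) (hc : 0 < c) (hc1 : c < 1)
    (hcut : ∀ ξ : ℕ → ℕ, StrictMono ξ → HasCutoff δ (productFamily (F ∘ ξ) (p ∘ ξ))) :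
    HasCutoff δ F := by
  refine hasCutoff_of_tendsto h.isReference.pos (fun a ha => ?_) fun a ha0 ha => ?_
  · have ha0 : 0 < a := zero_lt_one.trans ha
    refine squeeze_zero' (h.isReference.pos.mono fun n hn =>
      (h.chain n).maxDist_nonneg (mul_pos ha0 hn).le δ) ?_
      ((h.isReference_product hc hc1).tendsto_zero (hcut id strictMono_id) ha)
    exact h.pos.mono fun n hn => h.maxDist_le_product ha0 hn
  -- The tail bound is available only above `c`; smaller `a` follow from `b` by monotonicity in
  -- time.
  · obtain ⟨b, hb, hb1⟩ := exists_between (max_lt hc1 ha)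
    have hb0 : 0 < b := hc.trans ((le_max_left _ _).trans_lt hb)
    have key : Tendsto (fun n => maxDist δ (F n) (b * (p n * S n))) atTop (𝓝 1) := by
      refine tendsto_of_subseq_tendsto fun ns hns => ?_
      obtain ⟨φ, hφ, hnφ⟩ := strictMono_subseq_of_tendsto_atTop hns
      obtain ⟨ψ, hψ, hlim⟩ := (h.comp hc hnφ).exists_sparse hc hc1
        ((le_max_left _ _).trans_lt hb) hb1
      exact ⟨φ ∘ ψ, hlim (hcut _ (hnφ.comp hψ))⟩
    refine tendsto_of_tendsto_of_tendsto_of_le_of_le' key tendsto_const_nhds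
      (h.isReference.pos.mono fun n hn => (h.chain n).maxDist_anti δ (mul_pos ha0 hn).le
        (mul_le_mul_of_nonneg_right ((le_max_right _ _).trans hb.le) hn.le))
      (h.isReference.pos.mono fun n hn => (h.chain n).maxDist_le_one (mul_pos ha0 hn).le δ)

/-- If eventually all chains were below `κ`, the at most `m` late factors would keep the product
distance bounded away from 1 before its reference time. -/
theorem frequently_lt_of_product (h : IsRegular δ F p S c) (hc : 0 < c) (hc1 : c < 1)
    (hcut : HasCutoff δ (productFamily F p)) {a κ : ℝ} (ha : c < a) (ha1 : a < 1) (hκ0 : 0 ≤ κ)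
    (hκ : κ < 1) : ∃ᶠ i in atTop, κ < maxDist δ (F i) (a * (p i * S i)) ^ δ.order := by
  intro hn
  simp only [not_lt] at hn
  obtain ⟨m, hm⟩ := h.product_pow_le hc ha (η := 1 / 2) (by norm_num) (by norm_num)
  have h1 := hm κ hκ0 hκ.le hn
  have h2 := ((h.isReference_product hc hc1).tendsto_one hcut (hc.trans ha) ha1).pow δ.order
  rw [one_pow] at h2
  have h3 : 0 < (1 - κ) ^ m := pow_pos (sub_pos.2 hκ) m
  obtain ⟨n, h4, h5⟩ := (h1.and ((tendsto_order.1 h2).1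
    (1 - (1 - 1 / 2) * (1 - κ) ^ m) (by linarith))).exists
  exact absurd h5 (not_lt.2 h4)

theorem exists_subfamily_hasCutoff (h : IsRegular δ F p S c) (hc : 0 < c) (hc1 : c < 1)
    (hcut : HasCutoff δ (productFamily F p)) :
    ∃ ξ : ℕ → ℕ, StrictMono ξ ∧ HasCutoff δ (F ∘ ξ) := by
  have hlim : Tendsto (fun k : ℕ => (1 : ℝ) / (k + 2)) atTop (𝓝 0) := by
    have := (tendsto_one_div_add_atTop_nhds_zero_nat (𝕜 := ℝ)).comp (tendsto_add_atTop_nat 1)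
    refine this.congr fun k => ?_
    simp only [Function.comp_apply]
    push_cast
    ring
  have hk0 : ∀ k : ℕ, (0 : ℝ) < 1 / (k + 2) := fun k => by positivity
  have hk1 : ∀ k : ℕ, (1 : ℝ) / (k + 2) < 1 := fun k => by
    rw [div_lt_one (by positivity)]; linarith [(Nat.cast_nonneg k : (0 : ℝ) ≤ k)]
  -- Diagonal choice: the time factor stays in `(c, 1)` and tends to 1, while the level `κ` tends to
  -- 1 as well.
  obtain ⟨ξ, hξ, hP⟩ := extraction_forall_of_frequently fun k : ℕ =>
    h.frequently_lt_of_product hc hc1 hcut (a := 1 - (1 - c) * (1 / (k + 2)))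
      (κ := 1 - 1 / (k + 2)) (by nlinarith [hk1 k])
      (by linarith [mul_pos (sub_pos.2 hc1) (hk0 k)]) (by linarith [hk1 k]) (by linarith [hk0 k])
  have hpos := (h.comp hc hξ).isReference.pos
  refine ⟨ξ, hξ, hasCutoff_of_tendsto hpos (fun a ha => ?_) fun a ha0 ha => ?_⟩
  · have ha0 : 0 < a := zero_lt_one.trans ha
    have key : Tendsto (fun n => maxDist δ (F n) (a * (p n * S n))) atTop (𝓝 0) := by
      refine squeeze_zero' (h.isReference.pos.mono fun n hn =>
        (h.chain n).maxDist_nonneg (mul_pos ha0 hn).le δ) ?_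
        ((h.isReference_product hc hc1).tendsto_zero hcut ha)
      exact h.pos.mono fun n hn => h.maxDist_le_product ha0 hn
    exact key.comp hξ.tendsto_atTop
  · have h1 : Tendsto (fun k : ℕ => 1 - (1 - c) * ((1 : ℝ) / (k + 2))) atTop (𝓝 1) := by
      simpa using (hlim.const_mul (1 - c)).const_sub 1
    have h2 : Tendsto (fun k : ℕ => 1 - (1 : ℝ) / (k + 2)) atTop (𝓝 1) := by
      simpa using hlim.const_sub 1
    refine tendsto_of_tendsto_of_tendsto_of_le_of_le' h2 tendsto_const_nhds ?_
      (hpos.mono fun n hn => (h.chain _).maxDist_le_one (mul_pos ha0 hn).le δ)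
    filter_upwards [hpos, (tendsto_order.1 h1).1 a ha] with k hk hak
    have hb0 := (mul_pos (ha0.trans hak) hk).le
    refine (hP k).le.trans (le_trans (δ.pow_order_le_self ((h.chain _).maxDist_nonneg hb0 δ)
      ((h.chain _).maxDist_le_one hb0 δ)) ?_)
    exact (h.chain _).maxDist_anti δ (mul_pos ha0 hk).le
      (mul_le_mul_of_nonneg_right hak.le hk.le)

end IsRegular

/-! ### Decay beyond the mixing time. -/

section MixingTime

variable {M : MarkovTriple.{u}} {δ : Distance} {ε t : ℝ}

/-- The inequality is strict because the infimum need not be known to be attained. -/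
theorem maxDist_le_of_mixingTime_lt (h : M.IsStationaryChain)
    (hlt : mixingTime δ M ε < ENNReal.ofReal t) : maxDist δ M t ≤ ε := by
  simp only [mixingTime, iInf_lt_iff] at hlt
  obtain ⟨s, hs, hst⟩ := hlt
  refine (h.maxDist_anti δ s.2 ?_).trans hs
  rw [← ENNReal.ofReal_coe_nnreal] at hst
  exact (ENNReal.lt_ofReal_iff_toReal_lt ENNReal.ofReal_ne_top).1 hst |>.le.trans' (by simp)

theorem lt_maxDist_of_lt_mixingTime (ht : 0 ≤ t) (hlt : ENNReal.ofReal t < mixingTime δ M ε) :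
    ε < maxDist δ M t := by
  by_contra! hc
  refine absurd hlt (not_lt.2 ?_)
  exact iInf₂_le (⟨t, ht⟩ : ℝ≥0) hc |>.trans_eq (ENNReal.ofReal_eq_coe_nnreal ht).symm

theorem Distance.one_le_rho (δ : Distance) : 1 ≤ δ.rho := by
  cases δ <;> simp [Distance.rho]

/-- Exponential decay past a time after which the distance is at most `e`. -/
theorem maxDist_le_pow (h : M.IsStationaryChain) {τ e : ℝ} (hτ : 0 ≤ τ)
    (hle : ∀ s, τ < s → maxDist δ M s ≤ e) {k : ℕ} (hk : 0 < k) (hkt : k * τ < t) :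
    maxDist δ M t ≤ (2 * δ.rho * e) ^ k := by
  obtain ⟨k, rfl⟩ := Nat.exists_eq_succ_of_ne_zero hk.ne'
  have hk0 : (0 : ℝ) < (k + 1 : ℕ) := Nat.cast_pos.2 hk
  have hlt : τ < t / (k + 1 : ℕ) := by rwa [lt_div_iff₀ hk0, mul_comm]
  have ht : 0 ≤ t / (k + 1 : ℕ) := hτ.trans hlt.le
  have h1 := h.maxDist_nat_mul_le δ ht k
  rw [mul_div_cancel₀ _ hk0.ne'] at h1
  have h0 : 0 ≤ maxDist δ M t := h.maxDist_nonneg ((mul_nonneg hk0.le hτ).trans hkt.le) δ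
  have hρ := δ.one_le_rho
  calc maxDist δ M t ≤ 2 * δ.rho * maxDist δ M t := by nlinarith
    _ ≤ _ := h1
    _ ≤ _ := pow_le_pow_left₀ (mul_nonneg (by linarith) (h.maxDist_nonneg ht δ))
      (mul_le_mul_of_nonneg_left (hle _ hlt) (by linarith)) _

/-- Any `t > 0` splits into arbitrarily many positive pieces; this settles mixing time zero. -/
theorem maxDist_eq_zero (h : M.IsStationaryChain) {e : ℝ} (he : 0 ≤ e)
    (he1 : 2 * δ.rho * e < 1) (hle : ∀ s, 0 < s → maxDist δ M s ≤ e) (ht : 0 < t) :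
    maxDist δ M t = 0 := by
  refine le_antisymm ?_ (h.maxDist_nonneg ht.le δ)
  have hρ := δ.one_le_rho
  refine ge_of_tendsto (tendsto_pow_atTop_nhds_zero_of_lt_one (by positivity) he1) ?_
  filter_upwards [eventually_gt_atTop 0] with k hk
  exact maxDist_le_pow h le_rfl hle hk (by simpa using ht)

theorem maxDist_le_rpow (h : M.IsStationaryChain) {τ e a c x : ℝ} (he : 0 < e)
    (he1 : 2 * δ.rho * e < 1) (hle : ∀ s, τ < s → maxDist δ M s ≤ e) (hτ : 0 < τ) (hc : 0 < c)
    (hca : c < a) (hx : 2 / (a - c) ≤ x) :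
    maxDist δ M (a * x * τ) ^ δ.order ≤ (2 * δ.rho * e) ^ (c * δ.rho * x) := by
  have hρ := δ.one_le_rho
  have hac : 0 < a - c := sub_pos.2 hca
  have hx0 : 0 < x := (by positivity : 0 < 2 / (a - c)).trans_le hx
  have hb : 0 < 2 * δ.rho * e := by positivity
  rw [div_le_iff₀ hac] at hx
  have hax : 2 ≤ a * x := by nlinarith
  -- `k` is the largest integer strictly below `a * x`. As `(a - c) * x ≥ 2`, rounding still leaves
  -- `k ≥ c * x`, and `k ≥ 1`.
  obtain ⟨k, hk⟩ : ∃ k : ℕ, ⌈a * x⌉₊ = k + 1 :=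
    Nat.exists_eq_succ_of_ne_zero (Nat.ceil_pos.2 (by linarith)).ne'
  have hk1 : a * x ≤ k + 1 := by
    have := Nat.le_ceil (a * x)
    rw [hk] at this
    exact_mod_cast this
  have hk2 : (k : ℝ) < a * x := Nat.lt_ceil.1 (by omega)
  have hk0 : 0 < k := by
    have : (0 : ℝ) < k := by linarith
    exact_mod_cast this
  have h1 := maxDist_le_pow h hτ.le hle hk0 (mul_lt_mul_of_pos_right hk2 hτ)
  calc _ ≤ ((2 * δ.rho * e) ^ k) ^ δ.order :=
        pow_le_pow_left₀ (h.maxDist_nonneg (mul_nonneg (by linarith) hτ.le) δ) h1 _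
    _ = (2 * δ.rho * e) ^ ((k * δ.order : ℕ) : ℝ) := by rw [Real.rpow_natCast, pow_mul]
    _ ≤ _ := by
      refine Real.rpow_le_rpow_of_exponent_ge hb he1.le ?_
      push_cast
      rw [← δ.rho_eq]
      nlinarith

end MixingTime

/-! ### Regularity from the maximality and summation hypotheses. -/

section Hypotheses

theorem powInf_zero (b : ℝ) : powInf b 0 = 1 := by simp [powInf]

theorem powInf_ofReal {b x : ℝ} (hx : 0 ≤ x) :
    powInf b (ENNReal.ofReal x) = ENNReal.ofReal (b ^ x) := by
  simp [powInf, ENNReal.toReal_ofReal hx]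

/-- The exponent in the summation condition, for chains of mixing time `T` and weight `p`. -/
noncomputable def exponent (κ : ℝ) (T : ℕ → ℝ≥0∞) (p : ℕ → ℝ) (i n : ℕ) : ℝ≥0∞ :=
  ENNReal.ofReal κ * ((T n * ENNReal.ofReal (p i)) / (T i * ENNReal.ofReal (p n)))

variable {κ b : ℝ} {T : ℕ → ℝ≥0∞} {p : ℕ → ℝ}

theorem exponent_eq_zero_of_top (hp : ∀ n, 0 < p n) {i n : ℕ} (hi : T i = ∞) :
    exponent κ T p i n = 0 := by
  rw [exponent, hi, ENNReal.top_mul (ENNReal.ofReal_pos.2 (hp n)).ne', ENNReal.div_top, mul_zero]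

theorem exponent_eq_zero_of_zero {i n : ℕ} (hn : T n = 0) : exponent κ T p i n = 0 := by
  rw [exponent, hn, zero_mul, ENNReal.zero_div, mul_zero]

theorem exponent_eq (hκ : 0 ≤ κ) (hp : ∀ n, 0 < p n) {i n : ℕ} (hi : T i ≠ ∞) (hn : T n ≠ ∞)
    (hi0 : 0 < (T i).toReal) :
    exponent κ T p i n =
      ENNReal.ofReal (κ * (((T n).toReal / p n) / ((T i).toReal / p i))) := by
  rw [exponent, ← ENNReal.ofReal_toReal hi, ← ENNReal.ofReal_toReal hn,
    ← ENNReal.ofReal_mul ENNReal.toReal_nonneg, ← ENNReal.ofReal_mul ENNReal.toReal_nonneg,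
    ← ENNReal.ofReal_div_of_pos, ← ENNReal.ofReal_mul hκ]
  · congr 2
    rw [ENNReal.toReal_ofReal ENNReal.toReal_nonneg, ENNReal.toReal_ofReal ENNReal.toReal_nonneg]
    have := hp i
    have := hp n
    field_simp
  · exact mul_pos (by simpa using hi0) (hp n)

theorem exists_eventually_sum_lt
    (hsum : Tendsto (fun m : ℕ => limsup (fun n : ℕ => ∑ i ∈ Finset.range (n + 1 - m),
      powInf b (exponent κ T p i n)) atTop) atTop (𝓝 0)) {c : ℝ≥0∞} (hc : 0 < c) :
    ∃ m : ℕ, ∀ᶠ n in atTop, ∑ i ∈ Finset.range (n + 1 - m), powInf b (exponent κ T p i n) < c := by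
  obtain ⟨m, hm⟩ := ((tendsto_order.1 hsum).2 c hc).exists
  exact ⟨m, eventually_lt_of_limsup_lt hm⟩

/-- The exponents cannot all vanish. -/
theorem not_eventually_exponent_eq_zero
    (hsum : Tendsto (fun m : ℕ => limsup (fun n : ℕ => ∑ i ∈ Finset.range (n + 1 - m),
      powInf b (exponent κ T p i n)) atTop) atTop (𝓝 0)) :
    ∃ m : ℕ, ∀ᶠ n in atTop, ∀ i, i + m ≤ n → exponent κ T p i n ≠ 0 := by
  obtain ⟨m, hm⟩ := exists_eventually_sum_lt hsum one_pos
  refine ⟨m, hm.mono fun n hn i hi h0 => absurd hn (not_lt.2 ?_)⟩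
  rw [← powInf_zero b, ← h0]
  exact Finset.single_le_sum (f := fun i => powInf b (exponent κ T p i n))
    (fun _ _ => zero_le) (Finset.mem_range.2 (by omega))

/-- By maximality the chain at `max N j` also has infinite mixing time; its exponents vanish, so it
adds 1 to all later sums. -/
theorem ne_top_of_sum (hp : ∀ n, 0 < p n) {N : ℕ}
    (hmax : ∀ n, N ≤ n → ∀ i ≤ n, T i / ENNReal.ofReal (p i) ≤ T n / ENNReal.ofReal (p n))
    (hsum : Tendsto (fun m : ℕ => limsup (fun n : ℕ => ∑ i ∈ Finset.range (n + 1 - m),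
      powInf b (exponent κ T p i n)) atTop) atTop (𝓝 0)) (j : ℕ) : T j ≠ ∞ := by
  intro hj
  obtain ⟨m, hm⟩ := not_eventually_exponent_eq_zero hsum
  obtain ⟨n, hn, hn'⟩ := (hm.and (eventually_ge_atTop (max N j + m))).exists
  refine hn (max N j) hn' (exponent_eq_zero_of_top hp ?_)
  have h1 := hmax (max N j) (le_max_left _ _) j (le_max_right _ _)
  rw [hj, ENNReal.top_div_of_ne_top ENNReal.ofReal_ne_top, top_le_iff, ENNReal.div_eq_top] at h1
  rcases h1 with h1 | h1
  · exact absurd h1.2 (ENNReal.ofReal_pos.2 (hp _)).ne'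
  · exact h1.1

theorem eventually_ne_zero_of_sum
    (hsum : Tendsto (fun m : ℕ => limsup (fun n : ℕ => ∑ i ∈ Finset.range (n + 1 - m),
      powInf b (exponent κ T p i n)) atTop) atTop (𝓝 0)) : ∀ᶠ n in atTop, T n ≠ 0 := by
  obtain ⟨m, hm⟩ := not_eventually_exponent_eq_zero hsum
  filter_upwards [hm, eventually_ge_atTop m] with n hn hmn h0
  exact hn 0 (by omega) (exponent_eq_zero_of_zero h0)

theorem isRegular_of_mixingTime {δ : Distance} {F : ℕ → MarkovTriple.{u}}
    (hF : ∀ n, (F n).IsStationaryChain) (hp : ∀ n, 0 < p n) {c : ℝ} (hc : 0 < c) {N : ℕ}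
    {ε : ℕ → ℝ} {e₀ e₁ : ℝ} (he₀ : 0 < e₀) (hε₀ : ∀ n, e₀ ≤ ε n) (hε₁ : ∀ n, ε n ≤ e₁)
    (he₁ : 2 * δ.rho * e₁ < 1)
    (hmax : ∀ n, N ≤ n → ∀ i ≤ n, mixingTime δ (F i) (ε i) / ENNReal.ofReal (p i) ≤
      mixingTime δ (F n) (ε n) / ENNReal.ofReal (p n))
    (hsum : Tendsto (fun m : ℕ => limsup (fun n : ℕ => ∑ i ∈ Finset.range (n + 1 - m),
      powInf (2 * δ.rho * e₁) (exponent (c * δ.rho) (fun i => mixingTime δ (F i) (ε i)) p i n))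
        atTop) atTop (𝓝 0)) :
    IsRegular δ F p (fun n => (mixingTime δ (F n) (ε n)).toReal / p n) c := by
  set T : ℕ → ℝ≥0∞ := fun i => mixingTime δ (F i) (ε i) with hT
  have hρ := δ.one_le_rho
  have hfin : ∀ n, T n ≠ ∞ := ne_top_of_sum hp hmax hsum
  have he₁0 : 0 < e₁ := he₀.trans_le ((hε₀ 0).trans (hε₁ 0))
  have hpS : ∀ n, p n * ((T n).toReal / p n) = (T n).toReal := fun n =>
    mul_div_cancel₀ _ (hp n).ne'
  have hupper : ∀ n t, (T n).toReal < t → maxDist δ (F n) t ≤ e₁ := fun n t ht =>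
    (maxDist_le_of_mixingTime_lt (hF n) ((ENNReal.lt_ofReal_iff_toReal_lt (hfin n)).2 ht)).trans
      (hε₁ n)
  have hpos : ∀ᶠ n in atTop, 0 < (T n).toReal / p n :=
    (eventually_ne_zero_of_sum hsum).mono fun n hn =>
      div_pos (ENNReal.toReal_pos hn (hfin n)) (hp n)
  refine ⟨hF, hp, hpos, ?_, ⟨e₀, he₀, fun n t ht0 ht => ?_⟩, ⟨e₁, by nlinarith, fun n t _ ht => ?_⟩,
    fun a ha η hη => ?_⟩
  · filter_upwards [eventually_ge_atTop N] with n hn i hi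
    have h1 := ENNReal.toReal_mono (ENNReal.div_ne_top (hfin n) (ENNReal.ofReal_pos.2 (hp n)).ne')
      (hmax n hn i hi)
    rwa [ENNReal.toReal_div, ENNReal.toReal_div, ENNReal.toReal_ofReal (hp _).le,
      ENNReal.toReal_ofReal (hp _).le] at h1
  · rw [hpS] at ht
    exact (hε₀ n).trans (lt_maxDist_of_lt_mixingTime ht0
      ((ENNReal.ofReal_lt_iff_lt_toReal ht0 (hfin n)).2 ht)).le
  · rw [hpS] at ht
    exact hupper n t ht
  · have hb : 0 < 2 * δ.rho * e₁ := by positivity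
    have hκ : 0 < c * δ.rho := by positivity
    have ha0 : 0 < a := hc.trans ha
    -- The second entry of the minimum makes each single term so small that its ratio `x` exceeds `2
    -- / (a - c)`, as `maxDist_le_rpow` requires.
    obtain ⟨m, hm⟩ := exists_eventually_sum_lt hsum
      (c := ENNReal.ofReal (min η ((2 * δ.rho * e₁) ^ (c * δ.rho * (2 / (a - c))))))
      (ENNReal.ofReal_pos.2 (lt_min hη (Real.rpow_pos_of_pos hb _)))
    refine ⟨m, ?_⟩
    filter_upwards [hm, hpos] with n hn hSn
    have hnn : ∀ i, 0 ≤ p i * (a * ((T n).toReal / p n)) := fun i =>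
      mul_nonneg (hp i).le (mul_pos ha0 hSn).le
    have hx0 : ∀ i, 0 ≤ maxDist δ (F i) (p i * (a * ((T n).toReal / p n))) ^ δ.order := fun i =>
      pow_nonneg ((hF i).maxDist_nonneg (hnn i) δ) _
    have key : ∀ i ∈ Finset.range (n + 1 - m),
        ENNReal.ofReal (maxDist δ (F i) (p i * (a * ((T n).toReal / p n))) ^ δ.order) ≤
          powInf (2 * δ.rho * e₁) (exponent (c * δ.rho) T p i n) := by
      intro i hi
      rcases (ENNReal.toReal_nonneg : 0 ≤ (T i).toReal).eq_or_lt with h0 | h0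
      · rw [maxDist_eq_zero (hF i) he₁0.le he₁ (fun s hs => hupper i s (h0 ▸ hs))
          (mul_pos (hp i) (mul_pos ha0 hSn)), zero_pow δ.order_ne_zero, ENNReal.ofReal_zero]
        exact zero_le
      · have hSi : 0 < (T i).toReal / p i := div_pos h0 (hp i)
        set x := ((T n).toReal / p n) / ((T i).toReal / p i) with hx
        have hx0 : 0 < x := div_pos hSn hSi
        have h1 := (Finset.single_le_sum
          (f := fun i => powInf (2 * δ.rho * e₁) (exponent (c * δ.rho) T p i n))
          (fun _ _ => zero_le) hi).trans_lt hn
        simp only [exponent_eq hκ.le hp (hfin i) (hfin n) h0] at h1 ⊢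
        rw [← hx, powInf_ofReal (by positivity)] at h1 ⊢
        have h2 := ((ENNReal.ofReal_lt_ofReal_iff_of_nonneg
          (Real.rpow_nonneg hb.le _)).1 h1).trans_le (min_le_right _ _)
        rw [Real.rpow_lt_rpow_left_iff_of_base_lt_one hb he₁] at h2
        have h3 := (lt_of_mul_lt_mul_left h2 hκ.le).le
        refine ENNReal.ofReal_le_ofReal ?_
        have h4 := maxDist_le_rpow (hF i) he₁0 he₁ (hupper i) h0 hc ha h3
        have h5 : a * x * (T i).toReal = p i * (a * ((T n).toReal / p n)) := by
          have h6 : x * ((T i).toReal / p i) = (T n).toReal / p n := div_mul_cancel₀ _ hSi.ne'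
          rw [← h6]
          have := (hp i).ne'
          field_simp
        rwa [h5] at h4
    have h7 := (Finset.sum_le_sum key).trans hn.le
    rw [← ENNReal.ofReal_sum_of_nonneg fun i _ => hx0 i, ENNReal.ofReal_le_ofReal_iff
      (le_min hη.le (Real.rpow_nonneg hb.le _))] at h7
    exact h7.trans (min_le_left _ _)

end Hypotheses

end ProductCutoff

theorem theorem4p7 (δ : Distance)
    (F : ℕ → MarkovTriple.{u}) (hF : ∀ n, (F n).IsIrreducibleChain)
    (p : ℕ → ℝ) (hp : ∀ n, 0 < p n)
    (c₀ : ℝ) (hc₀ : 0 < c₀) (hc₀' : c₀ < 1) (N : ℕ)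
    (ε : ℕ → ℝ) (hε_inf : 0 < ⨅ n, ε n) (hε_bdd : BddAbove (Set.range ε))
    (hε_sup : ⨆ n, ε n < 1 / (2 * δ.rho))
    (hmax : ∀ n, N ≤ n →
      (Finset.range (n + 1)).sup
          (fun i => mixingTime δ (F i) (ε i) / ENNReal.ofReal (p i)) =
        mixingTime δ (F n) (ε n) / ENNReal.ofReal (p n))
    (hsum : Tendsto
      (fun m : ℕ => limsup
        (fun n : ℕ => ∑ i ∈ Finset.range (n + 1 - m),
          powInf (2 * δ.rho * ⨆ k, ε k)
            (ENNReal.ofReal (c₀ * δ.rho) *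
              ((mixingTime δ (F n) (ε n) * ENNReal.ofReal (p i)) /
                (mixingTime δ (F i) (ε i) * ENNReal.ofReal (p n)))))
        atTop)
      atTop (𝓝 0)) :
    (HasCutoff δ F ↔
      ∀ ξ : ℕ → ℕ, StrictMono ξ → HasCutoff δ (productFamily (F ∘ ξ) (p ∘ ξ))) ∧
    (HasCutoff δ F → HasCutoff δ (productFamily F p)) ∧
    ((∀ ξ : ℕ → ℕ, StrictMono ξ → ¬ HasCutoff δ (F ∘ ξ)) ↔
      ∀ ξ : ℕ → ℕ, StrictMono ξ → ¬ HasCutoff δ (productFamily (F ∘ ξ) (p ∘ ξ))) ∧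
    ((∀ ξ : ℕ → ℕ, StrictMono ξ → ¬ HasCutoff δ (F ∘ ξ)) →
      ¬ HasCutoff δ (productFamily F p)) ∧
    (∀ t : ℕ → ℝ, IsCutoffTime δ F t →
      IsCutoffTime δ (productFamily F p) (fun n => partialSum p n * t n / p n)) := by
  -- A real infimum of a set not bounded below is 0 by convention, which positivity excludes.
  have hbdd : BddBelow (Set.range ε) := by
    by_contra hc
    rw [Real.iInf_of_not_bddBelow hc] at hε_inf
    exact lt_irrefl _ hε_inf
  have hρ : 0 < 2 * δ.rho := by linarith [δ.one_le_rho]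
  have h := isRegular_of_mixingTime (fun n => (hF n).isStationaryChain) hp hc₀ hε_inf
    (fun n => ciInf_le hbdd n) (fun n => le_ciSup hε_bdd n)
    (by rwa [lt_div_iff₀ hρ, mul_comm] at hε_sup)
    (fun n hn i hi => (Finset.le_sup
      (f := fun i => mixingTime δ (F i) (ε i) / ENNReal.ofReal (p i))
      (Finset.mem_range.2 (Nat.lt_succ_of_le hi))).trans_eq (hmax n hn)) hsum
  refine ⟨⟨?_, h.hasCutoff_of_product hc₀ hc₀'⟩, ?_, ⟨?_, ?_⟩, ?_, ?_⟩
  · rintro ⟨t, ht⟩ ξ hξ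
    exact ⟨_, (h.comp hc₀ hξ).isCutoffTime_product hc₀ hc₀' (ht.comp hξ)⟩
  · rintro ⟨t, ht⟩
    exact ⟨_, h.isCutoffTime_product hc₀ hc₀' ht⟩
  · intro hno ξ hξ hcut
    obtain ⟨ζ, hζ, hcutζ⟩ := (h.comp hc₀ hξ).exists_subfamily_hasCutoff hc₀ hc₀' hcut
    exact hno (ξ ∘ ζ) (hξ.comp hζ) hcutζ
  · rintro hno ξ hξ ⟨t, ht⟩
    exact hno ξ hξ ⟨_, (h.comp hc₀ hξ).isCutoffTime_product hc₀ hc₀' ht⟩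
  · intro hno hcut
    obtain ⟨ξ, hξ, hcutξ⟩ := h.exists_subfamily_hasCutoff hc₀ hc₀' hcut
    exact hno ξ hξ hcutξ
  · exact fun t ht => h.isCutoffTime_product hc₀ hc₀' ht
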